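/- **Setting.** Let $X,Y$ be (real) Banach spaces. Let $A$ generate an exponentially stable $C_0$-semigroup $(e^{tA})_{t\ge0}$ on $X$ and let $B$ generate a $C_0$-semigroup $(e^{tB})_{t\ge0}$ on $Y$. Let $X_1=D(A)$, $Y_1=D(B)$, with norms equivalent to the graph norms. Let $\gamma,\delta\in(0,1]$, where $\gamma<1$ is allowed only if $(e^{tA})$ is holomorphic and $\delta<1$ only if $(e^{tB})$ is holomorphic. Let $X_\gamma$ and $Y_\delta$ be Banach spaces that are, up to equivalent norms, interpolation spaces between $X$ and $X_1$, respectively $Y$ and $Y_1$, with dense inclusions $X_1\hookrightarrow X_\gamma\hookrightarrow X$, $Y_1\hookrightarrow Y_\delta\hookrightarrow Y$ (and $X_\gamma=X_1$ if $\gamma=1$, $Y_\delta=Y_1$ if $\delta=1$). Assume that for some $M_A,C_A>0$ and $\omega_A<0$ $$\|e^{tA}\|_{\mathcal B(X_1)}\le M_Ae^{\omega_At},\qquad \|e^{tA}\|_{\mathcal B(X_\gamma,X_1)}\le C_At^{\gamma-1}e^{\omega_At}\qquad(t>0).$$ Let $f:X_1\times Y_1\to X_\gamma$ and $g:X_1\times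 Y_1\to Y_\delta$ satisfy $f(0,0)=0$, $g(0,0)=0$ and be Lipschitz continuous with constants $L_f,L_g>0$, where $X_1\times Y_1$ carries the norm $\|x\|_{X_1}+\|y\|_{Y_1}$. **Splitting.** Let $\epsilon,\zeta>0$ and let $Y=Y_F\oplus Y_S$ (depending on $\zeta$) with $Y_F,Y_S$ closed in $Y$ and with projections $\operatorname{pr}_F,\operatorname{pr}_S$ that commute with $B$ on $Y_1$. Equip $Y_F\cap Y_1$ and $Y_S\cap Y_1$ with the norm of $Y_1$, and write $f(x,y_F,y_S)=f(x,y_F+y_S)$, $g(x,y_F,y_S)=g(x,y_F+y_S)$. Assume: 1. for all $x,\tilde x\in X_1$, $y_F,\tilde y_F\in Y_F\cap Y_1$, $y_S,\tilde y_S\in Y_S\cap Y_1$, with $d=\|x-\tilde x\|_{X_1}+\|y_F-\tilde y_F\|_{Y_1}+\|y_S-\tilde y_S\|_{Y_1}$, $$\|\operatorname{pr}_S[g(x,y_F,y_S)-g(\tilde x,\tilde y_F,\tilde y_S)]\|_{Y_1}\le L_g\zeta^{\delta-1}d,\qquad \|\operatorname{pr}_F[g(x,y_F,y_S)-g(\tilde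 x,\tilde y_F,\tilde y_S)]\|_{Y_\delta}\le L_g d;$$ 2. the realization of $B$ in $Y_S$ generates a $C_0$-group $(e^{tB_S})_{t\in\mathbb R}$ on $Y_S$ with $e^{tB_S}=e^{tB}$ on $Y_S$ for $t\ge0$ (it is again written $e^{tB}$), and $0$ is in the resolvent set of the realization of $B$ in $Y_F$; 3. there are $C_B,M_B>0$ and $0\le N_F<N_S$ with $$\|e^{tB}y_F\|_{Y_1}\le C_Bt^{\delta-1}e^{(N_F+\zeta^{-1}\omega_A)t}\|y_F\|_{Y_\delta}\ (t>0,\ y_F\in Y_F\cap Y_\delta),$$ $$\|e^{-tB}y_S\|_{Y_1}\le M_Be^{-(N_S+\zeta^{-1}\omega_A)t}\|y_S\|_{Y_1}\ (t\ge0,\ y_S\in Y_S\cap Y_1);$$ 4. (gap condition) $2(\epsilon\zeta^{-1}-1)\omega_A+\epsilon(N_S+N_F)>0$ and $$\frac{2^{\gamma}L_fC_A\Gamma(\gamma)}{\big(2(\epsilon\zeta^{-1}-1)\omega_A+\epsilon(N_S+N_F)\big)^{\gamma}}+\frac{2^{\delta}L_gC_B\Gamma(\delta)}{(N_S-N_F)^{\delta}}+\frac{2\zeta^{\delta-1}L_gM_B\Gamma(\delta)}{N_S-N_F}<1.$$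 Put $\eta=\zeta^{-1}\omega_A+\frac{N_S+N_F}{2}$ and let $C_\eta$ be the space of all continuous $(u,v_F,v_S):(-\infty,0]\to X_1\times(Y_F\cap Y_1)\times(Y_S\cap Y_1)$ with $\sup_{t\le0}e^{-\eta t}(\|u(t)\|_{X_1}+\|v_F(t)\|_{Y_1}+\|v_S(t)\|_{Y_1})<\infty$. For $v_0\in Y_S\cap Y_1$ let $\mathscr L_{v_0}$ be the Lyapunov–Perron operator on $C_\eta$, $$\mathscr L_{v_0}\begin{pmatrix}u\\v_F\\v_S\end{pmatrix}(t)=\begin{pmatrix}\epsilon^{-1}\int_{-\infty}^te^{\epsilon^{-1}(t-s)A}f(u(s),v_F(s),v_S(s))\,ds\\ \int_{-\infty}^te^{(t-s)B}\operatorname{pr}_Fg(u(s),v_F(s),v_S(s))\,ds\\ e^{tB}v_0+\int_0^te^{(t-s)B}\operatorname{pr}_Sg(u(s),v_F(s),v_S(s))\,ds\end{pmatrix}.$$ **Statement.** Suppose in addition that $f$ and $g$ are continuously (Fréchet) differentiable, with $\|Df(x,y)\|_{\mathcal B(X_1\times Y_1,X_\gamma)}\le L_f$ and $\|Dg(x,y)\|_{\mathcal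 B(X_1\times Y_1,Y_\delta)}\le L_g$ for all $(x,y)$. Then for every $v_0\in Y_S\cap Y_1$ the operator $\mathscr L_{v_0}$ has exactly one fixed point $(u^{v_0},v_F^{v_0},v_S^{v_0})$ in $C_\eta$, and the slow-manifold map $$h^{\epsilon,\zeta}:Y_S\cap Y_1\to X_1\times(Y_F\cap Y_1),\qquad v_0\mapsto(u^{v_0}(0),v_F^{v_0}(0)),$$ is Fréchet differentiable at every point. Hence the slow manifold $S_{\epsilon,\zeta}=\{(h^{\epsilon,\zeta}(v_0),v_0):v_0\in Y_S\cap Y_1\}$ is the graph of a differentiable map. -/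

import Mathlib

open Set Filter Topology MeasureTheory

noncomputable section

namespace FastSlow

/-! ### Semigroups, groups and their generators -/

section Semigroups

variable {E : Type*} [NormedAddCommGroup E] [NormedSpace ℝ E]

/-- `S` restricted to `[0, ∞)` is a strongly continuous semigroup of bounded operators on `E`. -/
structure IsC0Semigroup (S : ℝ → E →L[ℝ] E) : Prop where
  map_zero : S 0 = 1
  map_add : ∀ s t : ℝ, 0 ≤ s → 0 ≤ t → S (s + t) = S s * S t
  tendsto_zero : ∀ x : E, Tendsto (fun t => S t x) (𝓝[>] 0) (𝓝 x)

/-- `G` is a strongly continuous group of bounded operators on `E`. -/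
structure IsC0Group (G : ℝ → E →L[ℝ] E) : Prop where
  map_zero : G 0 = 1
  map_add : ∀ s t : ℝ, G (s + t) = G s * G t
  tendsto_zero : ∀ x : E, Tendsto (fun t => G t x) (𝓝 0) (𝓝 x)

/-- The unbounded operator `A` is the infinitesimal generator of the `C₀`-semigroup `S`:
`x ∈ D(A)` and `A x = y` if and only if `t⁻¹ (S t x - x) → y` as `t ↓ 0`. -/
def Generates (A : E →ₗ.[ℝ] E) (S : ℝ → E →L[ℝ] E) : Prop :=
  IsC0Semigroup S ∧ ∀ x y : E, (x, y) ∈ A.graph ↔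
    Tendsto (fun t : ℝ => t⁻¹ • (S t x - x)) (𝓝[>] 0) (𝓝 y)

/-- The unbounded operator `A` is the infinitesimal generator of the `C₀`-group `G`. -/
def GeneratesGroup (A : E →ₗ.[ℝ] E) (G : ℝ → E →L[ℝ] E) : Prop :=
  IsC0Group G ∧ ∀ x y : E, (x, y) ∈ A.graph ↔
    Tendsto (fun t : ℝ => t⁻¹ • (G t x - x)) (𝓝[≠] 0) (𝓝 y)

/-- The open sector `{z ≠ 0 : |arg z| < θ}`. -/
def sector (θ : ℝ) : Set ℂ := {z | z ≠ 0 ∧ |z.arg| < θ}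

/-- The semigroup `S` is holomorphic: on the complexification `E + iE`, it extends to a
holomorphic semigroup `z ↦ P z + i Q z` on some sector around the positive half line, strongly
continuous at `0`. Here `P z`, `Q z` are the real and imaginary part of the extension, which acts by
`x + i y ↦ (P z x - Q z y) + i (Q z x + P z y)`; the complex derivative at `z` is `P' + i Q'`. -/
def IsHolomorphicSemigroup (S : ℝ → E →L[ℝ] E) : Prop :=
  ∃ θ : ℝ, 0 < θ ∧ θ ≤ Real.pi / 2 ∧ ∃ P Q : ℂ → E →L[ℝ] E,
    (∀ t : ℝ, 0 < t → P t = S t ∧ Q t = 0) ∧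
    (∀ z ∈ sector θ, ∀ w ∈ sector θ,
      P (z + w) = P z * P w - Q z * Q w ∧ Q (z + w) = P z * Q w + Q z * P w) ∧
    (∀ z ∈ sector θ, ∃ P' Q' : E →L[ℝ] E,
      HasFDerivAt P (Complex.reCLM.smulRight P' - Complex.imCLM.smulRight Q') z ∧
      HasFDerivAt Q (Complex.reCLM.smulRight Q' + Complex.imCLM.smulRight P') z) ∧
    (∀ x : E, Tendsto (fun z => P z x) (𝓝[sector θ] 0) (𝓝 x) ∧
      Tendsto (fun z => Q z x) (𝓝[sector θ] 0) (𝓝 0))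

/-- The realization of `B` in a subspace `V`, with domain `{v ∈ V ∩ D(B) : B v ∈ V}`. -/
def realization (B : E →ₗ.[ℝ] E) (V : Submodule ℝ E) : V →ₗ.[ℝ] V :=
  (B.graph.comap (V.subtype.prodMap V.subtype)).toLinearPMap

theorem mem_graph_realization_iff (B : E →ₗ.[ℝ] E) (V : Submodule ℝ E) (x y : V) :
    (x, y) ∈ (realization B V).graph ↔ ((x : E), (y : E)) ∈ B.graph := by
  unfold realization
  rw [Submodule.toLinearPMap_graph_eq]
  · rfl
  · rintro ⟨a, b⟩ hab h0
    simp only at h0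
    subst h0
    have h1 : ((0 : E), (b : E)) ∈ B.graph := hab
    exact Subtype.ext (B.graph_fst_eq_zero_snd h1 rfl)

end Semigroups

/-! ### The scale of spaces

Continuous inclusions between Banach spaces are given by injective continuous linear maps. -/

section Scales

variable {E E₁ Eθ : Type*} [NormedAddCommGroup E] [NormedSpace ℝ E]
  [NormedAddCommGroup E₁] [NormedSpace ℝ E₁] [NormedAddCommGroup Eθ] [NormedSpace ℝ Eθ]

/-- `E₁`, included into `E` by `ι`, is the domain of `A`; its norm is equivalent to the graph
norm. -/
structure IsDomainSpace (A : E →ₗ.[ℝ] E) (ι : E₁ →L[ℝ] E) : Prop where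
  injective : Function.Injective ι
  mem_domain_iff : ∀ x : E, x ∈ A.domain ↔ ∃ x₁ : E₁, ι x₁ = x
  norm_equiv : ∃ c C : ℝ, 0 < c ∧ ∀ (x₁ : E₁) (y : E), (ι x₁, y) ∈ A.graph →
    c * ‖x₁‖ ≤ ‖ι x₁‖ + ‖y‖ ∧ ‖ι x₁‖ + ‖y‖ ≤ C * ‖x₁‖

/-- `Eθ` is, up to an equivalent norm, a member of order `θ ∈ (0, 1]` of an interpolation scale
between `E` and `E₁`: there are dense continuous inclusions `j : E₁ → Eθ` and `ι : Eθ → E`, every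
bounded operator on `E` that restricts to a bounded operator on `E₁` restricts to a bounded operator
on `Eθ`, with norm controlled by the larger of the two norms, and `Eθ = E₁` if `θ = 1`. -/
structure IsScaleSpace (θ : ℝ) (ι₁ : E₁ →L[ℝ] E) (j : E₁ →L[ℝ] Eθ) (ι : Eθ →L[ℝ] E) : Prop where
  comp_eq : ∀ x : E₁, ι (j x) = ι₁ x
  injective : Function.Injective ι
  dense_left : DenseRange j
  dense_right : DenseRange ι
  interpolation : ∃ C : ℝ, ∀ (T : E →L[ℝ] E) (T₁ : E₁ →L[ℝ] E₁),
    (∀ x : E₁, ι₁ (T₁ x) = T (ι₁ x)) →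
    ∃ Tθ : Eθ →L[ℝ] Eθ, (∀ x : Eθ, ι (Tθ x) = T (ι x)) ∧ ‖Tθ‖ ≤ C * max ‖T‖ ‖T₁‖
  eq_of_one : θ = 1 → Function.Surjective j

end Scales

/-! ### Fast-slow systems -/

/-- The data and standing assumptions of the fast-slow system
`ε u' = A u + f(u, v)`, `v' = B v + g(u, v)`.
The spaces `X₁`, `Y₁` are the domains of `A`, `B`, and `Xγ`, `Yδ` are the spaces of orders
`γ`, `δ` in the scales of `A`, `B`. -/
structure System (X X₁ Xγ Y Y₁ Yδ : Type*)
    [NormedAddCommGroup X] [NormedSpace ℝ X] [NormedAddCommGroup X₁] [NormedSpace ℝ X₁]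
    [NormedAddCommGroup Xγ] [NormedSpace ℝ Xγ] [NormedAddCommGroup Y] [NormedSpace ℝ Y]
    [NormedAddCommGroup Y₁] [NormedSpace ℝ Y₁] [NormedAddCommGroup Yδ] [NormedSpace ℝ Yδ] where
  /-- the operators and the semigroups they generate -/
  A : X →ₗ.[ℝ] X
  expA : ℝ → X →L[ℝ] X
  B : Y →ₗ.[ℝ] Y
  expB : ℝ → Y →L[ℝ] Y
  generates_A : Generates A expA
  generates_B : Generates B expB
  exponentially_stable : ∃ M ω : ℝ, ω < 0 ∧ ∀ t : ℝ, 0 ≤ t → ‖expA t‖ ≤ M * Real.exp (ω * t)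
  /-- the scales of spaces -/
  γ : ℝ
  δ : ℝ
  γ_pos : 0 < γ
  γ_le_one : γ ≤ 1
  δ_pos : 0 < δ
  δ_le_one : δ ≤ 1
  holomorphic_A : γ < 1 → IsHolomorphicSemigroup expA
  holomorphic_B : δ < 1 → IsHolomorphicSemigroup expB
  ιX : X₁ →L[ℝ] X
  jX : X₁ →L[ℝ] Xγ
  ιXγ : Xγ →L[ℝ] X
  ιY : Y₁ →L[ℝ] Y
  jY : Y₁ →L[ℝ] Yδ
  ιYδ : Yδ →L[ℝ] Y
  domain_A : IsDomainSpace A ιX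
  domain_B : IsDomainSpace B ιY
  scale_X : IsScaleSpace γ ιX jX ιXγ
  scale_Y : IsScaleSpace δ ιY jY ιYδ
  /-- the decay and smoothing estimates for the fast semigroup -/
  ωA : ℝ
  MA : ℝ
  CA : ℝ
  ωA_neg : ωA < 0
  MA_pos : 0 < MA
  CA_pos : 0 < CA
  decay_A : ∀ t : ℝ, 0 < t → ∀ x : X₁, ∃ z : X₁, ιX z = expA t (ιX x) ∧
    ‖z‖ ≤ MA * Real.exp (ωA * t) * ‖x‖
  smoothing_A : ∀ t : ℝ, 0 < t → ∀ x : Xγ, ∃ z : X₁, ιX z = expA t (ιXγ x) ∧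
    ‖z‖ ≤ CA * t ^ (γ - 1) * Real.exp (ωA * t) * ‖x‖
  /-- the nonlinearities -/
  f : X₁ × Y₁ → Xγ
  g : X₁ × Y₁ → Yδ
  Lf : ℝ
  Lg : ℝ
  Lf_pos : 0 < Lf
  Lg_pos : 0 < Lg
  f_zero : f 0 = 0
  g_zero : g 0 = 0
  lipschitz_f : ∀ p q : X₁ × Y₁, ‖f p - f q‖ ≤ Lf * (‖p.1 - q.1‖ + ‖p.2 - q.2‖)
  lipschitz_g : ∀ p q : X₁ × Y₁, ‖g p - g q‖ ≤ Lg * (‖p.1 - q.1‖ + ‖p.2 - q.2‖)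

variable {X X₁ Xγ Y Y₁ Yδ : Type*}
  [NormedAddCommGroup X] [NormedSpace ℝ X] [NormedAddCommGroup X₁] [NormedSpace ℝ X₁]
  [NormedAddCommGroup Xγ] [NormedSpace ℝ Xγ] [NormedAddCommGroup Y] [NormedSpace ℝ Y]
  [NormedAddCommGroup Y₁] [NormedSpace ℝ Y₁] [NormedAddCommGroup Yδ] [NormedSpace ℝ Yδ]

/-- The nonlinearities are continuously differentiable, with derivatives bounded by `Lf` and `Lg`
in the operator norm, where `X₁ × Y₁` carries the norm `‖x‖ + ‖y‖`. -/
structure System.IsC1 (sys : System X X₁ Xγ Y Y₁ Yδ) : Prop where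
  contDiff_f : ContDiff ℝ 1 sys.f
  contDiff_g : ContDiff ℝ 1 sys.g
  fderiv_f_le : ∀ p q : X₁ × Y₁, ‖fderiv ℝ sys.f p q‖ ≤ sys.Lf * (‖q.1‖ + ‖q.2‖)
  fderiv_g_le : ∀ p q : X₁ × Y₁, ‖fderiv ℝ sys.g p q‖ ≤ sys.Lg * (‖q.1‖ + ‖q.2‖)

/-- A splitting `Y = YF ⊕ YS` of the slow variable space into a fast and a slow part, for the
parameter `ζ`. -/
structure Splitting (sys : System X X₁ Xγ Y Y₁ Yδ) (ζ : ℝ) where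
  YF : Submodule ℝ Y
  YS : Submodule ℝ Y
  isClosed_YF : IsClosed (YF : Set Y)
  isClosed_YS : IsClosed (YS : Set Y)
  isCompl : IsCompl YF YS
  /-- the projections commute with `B` -/
  commute_F : ∀ x y : Y, (x, y) ∈ sys.B.graph →
    (YF.projection YS isCompl x, YF.projection YS isCompl y) ∈ sys.B.graph
  commute_S : ∀ x y : Y, (x, y) ∈ sys.B.graph →
    (YS.projection YF isCompl.symm x, YS.projection YF isCompl.symm y) ∈ sys.B.graph
  /-- Lipschitz estimate for the slow part of `g`, with values in `Y₁` -/
  lipschitz_S : ∀ (x x' : X₁) (yF yF' yS yS' : Y₁), sys.ιY yF ∈ YF → sys.ιY yF' ∈ YF →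
    sys.ιY yS ∈ YS → sys.ιY yS' ∈ YS → ∃ w : Y₁,
      sys.ιY w = YS.projection YF isCompl.symm
        (sys.ιYδ (sys.g (x, yF + yS) - sys.g (x', yF' + yS'))) ∧
      ‖w‖ ≤ sys.Lg * ζ ^ (sys.δ - 1) * (‖x - x'‖ + ‖yF - yF'‖ + ‖yS - yS'‖)
  /-- Lipschitz estimate for the fast part of `g`, with values in `Yδ` -/
  lipschitz_F : ∀ (x x' : X₁) (yF yF' yS yS' : Y₁), sys.ιY yF ∈ YF → sys.ιY yF' ∈ YF →
    sys.ιY yS ∈ YS → sys.ιY yS' ∈ YS → ∃ w : Yδ,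
      sys.ιYδ w = YF.projection YS isCompl
        (sys.ιYδ (sys.g (x, yF + yS) - sys.g (x', yF' + yS'))) ∧
      ‖w‖ ≤ sys.Lg * (‖x - x'‖ + ‖yF - yF'‖ + ‖yS - yS'‖)
  /-- the realization of `B` in `YS` generates a `C₀`-group extending the semigroup of `B` -/
  expS : ℝ → YS →L[ℝ] YS
  generates_expS : GeneratesGroup (realization sys.B YS) expS
  expS_eq : ∀ t : ℝ, 0 ≤ t → ∀ y : YS, (expS t y : Y) = sys.expB t y
  /-- `0` belongs to the resolvent set of the realization of `B` in `YF` -/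
  zero_mem_resolvent : ∃ R : YF →L[ℝ] YF, (∀ y : YF, (R y, y) ∈ (realization sys.B YF).graph) ∧
    ∀ x y : YF, (x, y) ∈ (realization sys.B YF).graph → R y = x
  /-- the growth estimates on the two parts -/
  CB : ℝ
  MB : ℝ
  NF : ℝ
  NS : ℝ
  CB_pos : 0 < CB
  MB_pos : 0 < MB
  NF_nonneg : 0 ≤ NF
  NF_lt_NS : NF < NS
  decay_F : ∀ t : ℝ, 0 < t → ∀ y : Yδ, sys.ιYδ y ∈ YF → ∃ z : Y₁,
    sys.ιY z = sys.expB t (sys.ιYδ y) ∧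
    ‖z‖ ≤ CB * t ^ (sys.δ - 1) * Real.exp ((NF + ζ⁻¹ * sys.ωA) * t) * ‖y‖
  decay_S : ∀ t : ℝ, 0 ≤ t → ∀ (y : Y₁) (hy : sys.ιY y ∈ YS), ∃ z : Y₁,
    sys.ιY z = expS (-t) ⟨sys.ιY y, hy⟩ ∧
    ‖z‖ ≤ MB * Real.exp (-(NS + ζ⁻¹ * sys.ωA) * t) * ‖y‖

namespace Splitting

variable {sys : System X X₁ Xγ Y Y₁ Yδ} {ζ : ℝ} (spl : Splitting sys ζ)

/-- The gap condition. The first denominator is `(2 (ε η - ωA)) ^ γ` for the weight `η` below; its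
base has to be positive for the expression to be meaningful. -/
def GapCondition (ε : ℝ) : Prop :=
  0 < 2 * (ε * ζ⁻¹ - 1) * sys.ωA + ε * (spl.NS + spl.NF) ∧
  2 ^ sys.γ * sys.Lf * sys.CA * Real.Gamma sys.γ /
      (2 * (ε * ζ⁻¹ - 1) * sys.ωA + ε * (spl.NS + spl.NF)) ^ sys.γ +
    2 ^ sys.δ * sys.Lg * spl.CB * Real.Gamma sys.δ / (spl.NS - spl.NF) ^ sys.δ +
    2 * ζ ^ (sys.δ - 1) * sys.Lg * spl.MB * Real.Gamma sys.δ / (spl.NS - spl.NF) < 1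

/-- `YF ∩ Y₁`, with the norm of `Y₁`. -/
abbrev YF₁ : Submodule ℝ Y₁ := spl.YF.comap sys.ιY.toLinearMap

/-- `YS ∩ Y₁`, with the norm of `Y₁`. -/
abbrev YS₁ : Submodule ℝ Y₁ := spl.YS.comap sys.ιY.toLinearMap

/-- The weight `η = ζ⁻¹ ωA + (NS + NF) / 2`. -/
def η : ℝ := ζ⁻¹ * sys.ωA + (spl.NS + spl.NF) / 2

/-- Membership in `C_η`: the continuous function `U = (u, v_F, v_S)` on `(-∞, 0]` satisfies
`sup_{t ≤ 0} e^{-η t} (‖u t‖ + ‖v_F t‖ + ‖v_S t‖) < ∞`. -/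
def MemCη (U : C(Iic (0 : ℝ), X₁ × spl.YF₁ × spl.YS₁)) : Prop :=
  BddAbove (range fun t : Iic (0 : ℝ) =>
    Real.exp (-spl.η * t) * (‖(U t).1‖ + ‖(U t).2.1‖ + ‖(U t).2.2‖))

/-- The point of `X₁ × Y₁` at which the nonlinearities are evaluated along `U` at time `s`, that
is `(u s, v_F s + v_S s)` for `s ≤ 0` (only such `s` are used). -/
def point (U : C(Iic (0 : ℝ), X₁ × spl.YF₁ × spl.YS₁)) (s : ℝ) : X₁ × Y₁ :=
  ((IicExtend U s).1, ((IicExtend U s).2.1 : Y₁) + ((IicExtend U s).2.2 : Y₁))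

/-- The Lyapunov-Perron operator, applied to `U` and evaluated at `t ≤ 0`, with values regarded in
`X × Y × Y`. For `U` in `C_η`, all integrals converge absolutely. -/
def lyapunovPerron (ε : ℝ) (v₀ : spl.YS₁) (U : C(Iic (0 : ℝ), X₁ × spl.YF₁ × spl.YS₁)) (t : ℝ) :
    X × Y × Y :=
  (ε⁻¹ • ∫ s in Iic t, sys.expA (ε⁻¹ * (t - s)) (sys.ιXγ (sys.f (spl.point U s))),
   ∫ s in Iic t, sys.expB (t - s)
      (spl.YF.projection spl.YS spl.isCompl (sys.ιYδ (sys.g (spl.point U s)))),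
   (spl.expS t ⟨sys.ιY v₀, v₀.2⟩ : Y) + ∫ s in (0 : ℝ)..t, (spl.expS (t - s)
      (spl.YS.projectionOnto spl.YF spl.isCompl.symm (sys.ιYδ (sys.g (spl.point U s)))) : Y))

/-- `U` is a fixed point in `C_η` of the Lyapunov-Perron operator. -/
def IsFixedPoint (ε : ℝ) (v₀ : spl.YS₁) (U : C(Iic (0 : ℝ), X₁ × spl.YF₁ × spl.YS₁)) : Prop :=
  spl.MemCη U ∧ ∀ t : Iic (0 : ℝ),
    (sys.ιX (U t).1, sys.ιY (U t).2.1, sys.ιY (U t).2.2) = spl.lyapunovPerron ε v₀ U t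

open Classical in
/-- The slow manifold map `h : YS ∩ Y₁ → X₁ × (YF ∩ Y₁)`, sending `v₀` to the first two components
at time `0` of the fixed point of the Lyapunov-Perron operator (and to `0` if there is none). -/
def slowManifoldMap (ε : ℝ) (v₀ : spl.YS₁) : X₁ × spl.YF₁ :=
  if h : ∃ U, spl.IsFixedPoint ε v₀ U then
    ((h.choose ⟨0, self_mem_Iic⟩).1, (h.choose ⟨0, self_mem_Iic⟩).2.1)
  else 0

end Splitting

end FastSlow

end

/-! The fixed point equation is one convolution equation U = Λv₀ + T * F(U) on the negative half
line, where Λv₀ is the free evolution and T(r) consists of the two smoothing semigroups for r > 0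
and of minus the backward group on `YS` for r ≤ 0 (`lyapunovPerron_eq`). The Lipschitz constants are
moved from F into T, which makes F 1-Lipschitz. If κ bounds ‖T‖, convolution with T acts on
functions of size e^{ηt} with norm at most q(η) = ∫ κ(r) e^{-ηr} dr. Evaluated by Gamma integrals,
q(η) is at most the left side of the gap condition (`GapCondition.kernelMass_lt_one`), and
contraction gives exactly one fixed point.

For differentiability, the obstacle is that the Taylor remainder of U ↦ F(U) need not be small
uniformly as t → -∞. It is small when increments have size e^{νt} with ν > η and the remainder is
measured against e^{ηt} (`exists_norm_superposition_remainder_le`). Since q is continuous and q(η) <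
1, some ν > η also has q(ν) < 1 (`exists_gt_kernelMass_lt_one`). By uniqueness the solutions have
size e^{νt}, and there they are Lipschitz in v₀. The linearised equation W = Λk + T * (F'(U)W) is
solvable because ‖F'‖ ≤ 1, and U(v₀ + k) - U(v₀) - W obeys the same contractive estimate with
forcing o(‖k‖) (`differentiable_solution`).

F has to be C¹ with values in `YS ∩ Y₁`, although g is differentiable only into `Yδ`. This holds
because the slow projection maps `Yδ` boundedly into `Y₁`: its values lie there by commutation with
B if δ = 1 and by holomorphy otherwise, and the closed graph theorem gives boundedness
(`exists_eq_prS`, `exists_prSδ`). -/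

noncomputable section

namespace FastSlow

/-! ### Convolution on the negative half line -/

section Convolution

variable {E Z : Type*} [NormedAddCommGroup E] [NormedSpace ℝ E]
  [NormedAddCommGroup Z] [NormedSpace ℝ Z]

/-- A strongly continuous operator-valued kernel, with a possible jump at `0`, dominated in norm
by `κ`. -/
structure IsConvKernel (T : ℝ → E →L[ℝ] Z) (κ : ℝ → ℝ) : Prop where
  continuousOn : ContinuousOn (fun p : ℝ × E => T p.1 p.2) ({0}ᶜ ×ˢ univ)
  norm_le : ∀ r, r ≠ 0 → ‖T r‖ ≤ κ r

/-- The convolution over the negative half line, `∫_{s ≤ 0} T (t - s) (φ s) ds`. -/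
def conv (T : ℝ → E →L[ℝ] Z) (φ : ℝ → E) (t : ℝ) : Z := ∫ s in Iic 0, T (t - s) (φ s)

variable {T : ℝ → E →L[ℝ] Z} {κ : ℝ → ℝ} {η M : ℝ} {φ ψ : ℝ → E}

theorem IsConvKernel.nonneg (hT : IsConvKernel T κ) {r : ℝ} (hr : r ≠ 0) : 0 ≤ κ r :=
  (norm_nonneg _).trans (hT.norm_le r hr)

theorem IsConvKernel.integral_nonneg (hT : IsConvKernel T κ) :
    0 ≤ ∫ r, κ r * Real.exp (-η * r) := by
  refine integral_nonneg_of_ae ?_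
  filter_upwards [Measure.ae_ne volume (0 : ℝ)] with r hr
  exact mul_nonneg (hT.nonneg hr) (Real.exp_pos _).le

theorem conv_congr {t : ℝ} (h : ∀ s ≤ 0, φ s = ψ s) : conv T φ t = conv T ψ t :=
  setIntegral_congr_fun measurableSet_Iic fun s hs => by simp only [h s hs]

/-- The weight factors as e^{ηs} = e^{ηt} e^{-η(t-s)}, which leaves a translate of the integrand of
the weighted mass of `κ`. The point s = t is excluded because `κ` controls the kernel only off 0. -/
theorem IsConvKernel.ae_norm_le (hT : IsConvKernel T κ) (hM : ∀ s ≤ 0, ‖φ s‖ ≤ M * Real.exp (η * s))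
    (t : ℝ) : ∀ᵐ s ∂volume.restrict (Iic (0 : ℝ)), ‖T (t - s) (φ s)‖ ≤
      M * Real.exp (η * t) * (κ (t - s) * Real.exp (-η * (t - s))) := by
  rw [ae_restrict_iff' measurableSet_Iic]
  filter_upwards [Measure.ae_ne volume t] with s hst hs
  have h0 : t - s ≠ 0 := sub_ne_zero.2 (Ne.symm hst)
  have : Real.exp (η * s) = Real.exp (η * t) * Real.exp (-η * (t - s)) := by
    rw [← Real.exp_add]; ring_nf
  calc ‖T (t - s) (φ s)‖ ≤ κ (t - s) * (M * Real.exp (η * s)) :=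
        (T (t - s)).le_of_opNorm_le_of_le (hT.norm_le _ h0) (hM s hs)
    _ = _ := by rw [this]; ring

theorem IsConvKernel.integrableOn (hT : IsConvKernel T κ)
    (hκ : Integrable fun r => κ r * Real.exp (-η * r)) (hφ : ContinuousOn φ (Iic 0))
    (hM : ∀ s ≤ 0, ‖φ s‖ ≤ M * Real.exp (η * s)) (t : ℝ) :
    IntegrableOn (fun s => T (t - s) (φ s)) (Iic 0) := by
  refine Integrable.mono' (g := fun s => M * Real.exp (η * t) *
    (κ (t - s) * Real.exp (-η * (t - s)))) ?_ ?_ (hT.ae_norm_le hM t)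
  · exact ((hκ.comp_sub_left t).const_mul _).restrict
  -- The kernel may jump at 0, so s = t is removed before continuity is used for measurability.
  · have h1 : (Iic (0 : ℝ) \ {t} : Set ℝ) =ᵐ[volume] Iic (0 : ℝ) :=
      sdiff_null_ae_eq_self (by simp)
    rw [← Measure.restrict_congr_set h1]
    refine ContinuousOn.aestronglyMeasurable ?_ (measurableSet_Iic.diff (measurableSet_singleton t))
    have h2 : ContinuousOn (fun s => (t - s, φ s)) (Iic (0 : ℝ) \ {t}) :=
      (by fun_prop : ContinuousOn (fun s => t - s) _).prodMk (hφ.mono sdiff_subset)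
    exact hT.continuousOn.comp h2 fun s hs =>
      ⟨sub_ne_zero.2 fun h => hs.2 h.symm, mem_univ _⟩

/-- A Young inequality: enlarging the domain to the whole line gives a constant independent of `t`.
This constant is the contraction factor later on. -/
theorem IsConvKernel.norm_conv_le (hT : IsConvKernel T κ)
    (hκ : Integrable fun r => κ r * Real.exp (-η * r)) (hM0 : 0 ≤ M)
    (hM : ∀ s ≤ 0, ‖φ s‖ ≤ M * Real.exp (η * s)) (t : ℝ) :
    ‖conv T φ t‖ ≤ (∫ r, κ r * Real.exp (-η * r)) * M * Real.exp (η * t) := by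
  have hi := (hκ.comp_sub_left t).const_mul (M * Real.exp (η * t))
  calc ‖conv T φ t‖ ≤ ∫ s in Iic (0 : ℝ), M * Real.exp (η * t) *
        (κ (t - s) * Real.exp (-η * (t - s))) :=
        norm_integral_le_of_norm_le hi.restrict (hT.ae_norm_le hM t)
    _ ≤ ∫ s, M * Real.exp (η * t) * (κ (t - s) * Real.exp (-η * (t - s))) := by
        refine setIntegral_le_integral hi ?_
        filter_upwards [Measure.ae_ne volume t] with s hst
        have := hT.nonneg (sub_ne_zero.2 (Ne.symm hst))
        simp only [Pi.zero_apply]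
        positivity
    _ = _ := by
        rw [integral_const_mul,
          integral_sub_left_eq_self (fun r => κ r * Real.exp (-η * r)) volume t]
        ring

theorem IsConvKernel.conv_sub (hT : IsConvKernel T κ)
    (hκ : Integrable fun r => κ r * Real.exp (-η * r)) {M' : ℝ} (hφ : ContinuousOn φ (Iic 0))
    (hM : ∀ s ≤ 0, ‖φ s‖ ≤ M * Real.exp (η * s)) (hψ : ContinuousOn ψ (Iic 0))
    (hM' : ∀ s ≤ 0, ‖ψ s‖ ≤ M' * Real.exp (η * s)) (t : ℝ) :
    conv T (fun s => φ s - ψ s) t = conv T φ t - conv T ψ t := by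
  simp only [conv, map_sub]
  exact integral_sub (hT.integrableOn hκ hφ hM t) (hT.integrableOn hκ hψ hM' t)

theorem IsConvKernel.continuous_conv (hT : IsConvKernel T κ)
    (hκ : Integrable fun r => κ r * Real.exp (-η * r)) (hφ : ContinuousOn φ (Iic 0))
    (hM : ∀ s ≤ 0, ‖φ s‖ ≤ M * Real.exp (η * s)) : Continuous (conv T φ) := by
  have hM0 : 0 ≤ M := by simpa using (norm_nonneg _).trans (hM 0 le_rfl)
  -- Freezing `φ` at its value at 0 gives a function continuous on the whole line.
  set χ : ℝ → E := fun s => φ (min s 0) with hχdef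
  have hχ : Continuous χ := hφ.comp_continuous (by fun_prop) fun s => mem_Iic.2 (min_le_right _ _)
  have hφχ : ∀ s ≤ 0, φ s = χ s := fun s hs => by simp [χ, min_eq_left hs]
  -- The substitution r = t - s frees the kernel from `t`, so that dominated convergence applies.
  have hrep : conv T φ = fun t => ∫ r, (Ici t).indicator (fun r => T r (χ (t - r))) r := by
    funext t
    rw [conv_congr hφχ, conv, ← integral_indicator measurableSet_Iic,
      ← integral_sub_left_eq_self _ volume t]
    refine integral_congr_ae (Eventually.of_forall fun r => ?_)
    simp only [indicator, mem_Iic, mem_Ici, sub_nonpos, sub_sub_cancel]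
  rw [hrep, continuous_iff_continuousAt]
  intro t₀
  have hb : ∀ t r, t ≤ r → r ≠ 0 → |t - t₀| < 1 → ‖T r (χ (t - r))‖ ≤
      (M * Real.exp (η * t₀ + |η|)) * (κ r * Real.exp (-η * r)) := by
    intro t r htr hr ht
    have h1 := hM (t - r) (sub_nonpos.2 htr)
    rw [hφχ _ (sub_nonpos.2 htr)] at h1
    have h2 : Real.exp (η * (t - r)) ≤ Real.exp (η * t₀ + |η|) * Real.exp (-η * r) := by
      rw [← Real.exp_add]
      refine Real.exp_le_exp.2 ?_
      have h3 : η * (t - t₀) ≤ |η| := (le_abs_self _).trans (by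
        rw [abs_mul]; exact mul_le_of_le_one_right (abs_nonneg _) ht.le)
      linarith
    calc ‖T r (χ (t - r))‖ ≤ κ r * (M * (Real.exp (η * t₀ + |η|) * Real.exp (-η * r))) :=
          (T r).le_of_opNorm_le_of_le (hT.norm_le _ hr)
            (h1.trans (mul_le_mul_of_nonneg_left h2 hM0))
      _ = _ := by ring
  have hnear : ∀ᶠ t in 𝓝 t₀, |t - t₀| < 1 := by
    filter_upwards [Metric.ball_mem_nhds t₀ one_pos] with t ht
    simpa [Real.dist_eq] using ht
  refine continuousAt_of_dominated (bound := fun r =>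
    (M * Real.exp (η * t₀ + |η|)) * (κ r * Real.exp (-η * r))) ?_ ?_ (hκ.const_mul _) ?_
  · refine Eventually.of_forall fun t => ?_
    rw [aestronglyMeasurable_indicator_iff measurableSet_Ici]
    have h1 : (Ici t \ {0} : Set ℝ) =ᵐ[volume] Ici t := sdiff_null_ae_eq_self (by simp)
    rw [← Measure.restrict_congr_set h1]
    refine ContinuousOn.aestronglyMeasurable ?_ (measurableSet_Ici.diff (measurableSet_singleton 0))
    have h2 : ContinuousOn (fun r => (r, χ (t - r))) (Ici t \ {0}) :=
      (by fun_prop : Continuous _).continuousOn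
    exact hT.continuousOn.comp h2 fun s hs => ⟨hs.2, mem_univ _⟩
  · filter_upwards [hnear] with t ht
    filter_upwards [Measure.ae_ne volume (0 : ℝ)] with r hr
    by_cases htr : t ≤ r
    · rw [indicator_of_mem (show r ∈ Ici t from htr)]
      exact hb t r htr hr ht
    · rw [indicator_of_notMem (show r ∉ Ici t from htr), norm_zero]
      have := hT.nonneg hr
      positivity
  -- For r ≠ t₀ the indicator of t ≤ r is constant for t near t₀.
  · filter_upwards [Measure.ae_ne volume t₀] with r hr
    rcases lt_or_gt_of_ne hr with h | h
    · refine (continuousAt_const (y := (0 : Z))).congr ?_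
      filter_upwards [lt_mem_nhds h] with t ht
      rw [indicator_of_notMem (show r ∉ Ici t from not_le.2 ht)]
    · have : ContinuousAt (fun t => T r (χ (t - r))) t₀ :=
        ((T r).continuous.comp (hχ.comp (by fun_prop))).continuousAt
      refine this.congr ?_
      filter_upwards [gt_mem_nhds h] with t ht
      rw [indicator_of_mem (show r ∈ Ici t from le_of_lt ht)]

/-- A function dominated by its own convolution with a contractive kernel, up to a small error. -/
theorem IsConvKernel.norm_le_of_conv (hT : IsConvKernel T κ)
    (hκ : Integrable fun r => κ r * Real.exp (-η * r)) (hq : ∫ r, κ r * Real.exp (-η * r) < 1)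
    {U : ℝ → Z} {C α β : ℝ} (hβ : 0 ≤ β) (hC : ∀ t ≤ 0, ‖U t‖ ≤ C * Real.exp (η * t))
    (hφ : ∀ t ≤ 0, ‖φ t‖ ≤ ‖U t‖ + β * Real.exp (η * t))
    (hU : ∀ t ≤ 0, ‖U t - conv T φ t‖ ≤ α * Real.exp (η * t)) {t : ℝ} (ht : t ≤ 0) :
    ‖U t‖ ≤ (α + (∫ r, κ r * Real.exp (-η * r)) * β) / (1 - ∫ r, κ r * Real.exp (-η * r)) *
      Real.exp (η * t) := by
  set q := ∫ r, κ r * Real.exp (-η * r)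
  have hq0 : 0 ≤ q := hT.integral_nonneg
  have hexp : ∀ a t : ℝ, ∀ x : ℝ, x ≤ a * Real.exp (η * t) ↔ x / Real.exp (η * t) ≤ a :=
    fun a t x => (div_le_iff₀ (Real.exp_pos _)).symm
  set S : Set ℝ := (fun t => ‖U t‖ / Real.exp (η * t)) '' Iic 0
  have hne : S.Nonempty := nonempty_Iic.image _
  have hbd : BddAbove S := ⟨C, by
    rintro _ ⟨t, ht, rfl⟩
    exact (hexp _ _ _).1 (hC t ht)⟩
  have hle : ∀ t ≤ 0, ‖U t‖ ≤ sSup S * Real.exp (η * t) := fun t ht =>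
    (hexp _ _ _).2 (le_csSup hbd ⟨t, ht, rfl⟩)
  have hS0 : 0 ≤ sSup S := by simpa using (norm_nonneg _).trans (hle 0 le_rfl)
  -- As q < 1 and the supremum is finite by `hC`, this inequality can be solved for the supremum.
  have hstep : sSup S ≤ α + q * (sSup S + β) := by
    refine csSup_le hne ?_
    rintro _ ⟨t, ht, rfl⟩
    refine (hexp _ _ _).1 ?_
    have h1 := hT.norm_conv_le hκ (add_nonneg hS0 hβ) (fun s hs =>
      (hφ s hs).trans (by rw [add_mul]; exact add_le_add_left (hle s hs) _)) t
    calc ‖U t‖ ≤ ‖U t - conv T φ t‖ + ‖conv T φ t‖ := norm_le_norm_sub_add _ _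
      _ ≤ _ := (add_le_add (hU t ht) h1).trans_eq (by ring)
  refine (hle t ht).trans (mul_le_mul_of_nonneg_right ?_ (Real.exp_pos _).le)
  rw [le_div_iff₀ (by linarith)]
  linarith

/-- Banach's fixed point theorem for the rescaled unknown e^{-ηt} U(t) among bounded continuous
functions. `G` may depend on time, so that the linearisation along a solution is covered as well. -/
theorem IsConvKernel.exists_solution [CompleteSpace Z] (hT : IsConvKernel T κ)
    (hκ : Integrable fun r => κ r * Real.exp (-η * r)) (hq : ∫ r, κ r * Real.exp (-η * r) < 1)
    {G : ℝ → Z → E} (hG : ContinuousOn (fun p : ℝ × Z => G p.1 p.2) (Iic 0 ×ˢ univ))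
    (hGlip : ∀ s ≤ 0, ∀ z z', ‖G s z - G s z'‖ ≤ ‖z - z'‖) (hG0 : ∀ s ≤ 0, G s 0 = 0)
    {b : ℝ → Z} {C : ℝ} (hb : ContinuousOn b (Iic 0))
    (hC : ∀ t ≤ 0, ‖b t‖ ≤ C * Real.exp (η * t)) :
    ∃ U : ℝ → Z, ContinuousOn U (Iic 0) ∧ (∃ C', ∀ t ≤ 0, ‖U t‖ ≤ C' * Real.exp (η * t)) ∧
      ∀ t ≤ 0, U t = b t + conv T (fun s => G s (U s)) t := by
  set q := ∫ r, κ r * Real.exp (-η * r) with hqdef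
  have hq0 : 0 ≤ q := hT.integral_nonneg
  let V : BoundedContinuousFunction (Iic (0 : ℝ)) Z → ℝ → Z :=
    fun w s => Real.exp (η * s) • IicExtend w s
  have hVc : ∀ w, Continuous (V w) := fun w => by
    have : Continuous (IicExtend w : ℝ → Z) := w.continuous.comp
      (Continuous.subtype_mk (by fun_prop : Continuous fun s : ℝ => min 0 s) _)
    fun_prop
  have hVsub : ∀ w w' s, ‖V w s - V w' s‖ ≤ dist w w' * Real.exp (η * s) := fun w w' s => by
    simp only [V]
    rw [← smul_sub, norm_smul, Real.norm_of_nonneg (Real.exp_pos _).le, mul_comm, ← dist_eq_norm]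
    exact mul_le_mul_of_nonneg_right (w.dist_coe_le_dist _) (Real.exp_pos _).le
  have hV0 : V 0 = 0 := by funext s; simp [V, IicExtend]
  have hVle : ∀ w s, ‖V w s‖ ≤ ‖w‖ * Real.exp (η * s) := fun w s => by
    simpa [hV0] using hVsub w 0 s
  let N : BoundedContinuousFunction (Iic (0 : ℝ)) Z → ℝ → E := fun w s => G s (V w s)
  have hNc : ∀ w, ContinuousOn (N w) (Iic 0) := fun w =>
    hG.comp (f := fun s => (s, V w s)) (continuousOn_id.prodMk (hVc w).continuousOn)
      fun s hs => ⟨hs, mem_univ _⟩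
  have hNsub : ∀ w w', ∀ s ≤ 0, ‖N w s - N w' s‖ ≤ dist w w' * Real.exp (η * s) :=
    fun w w' s hs => (hGlip s hs _ _).trans (hVsub w w' s)
  have hNle : ∀ w, ∀ s ≤ 0, ‖N w s‖ ≤ ‖w‖ * Real.exp (η * s) := fun w s hs => by
    have := hNsub w 0 s hs
    simpa [N, hV0, hG0 s hs] using this
  have hexp : ∀ t, Real.exp (-η * t) * Real.exp (η * t) = 1 := fun t => by
    rw [← Real.exp_add]; simp
  let Φ : BoundedContinuousFunction (Iic (0 : ℝ)) Z → BoundedContinuousFunction (Iic (0 : ℝ)) Z :=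
    fun w => BoundedContinuousFunction.ofNormedAddCommGroup
      (fun t : Iic (0 : ℝ) => Real.exp (-η * t) • (b t + conv T (N w) t))
      (by
        have h1 := (continuousOn_iff_continuous_domRestrict.1 hb)
        have h2 := (hT.continuous_conv hκ (hNc w) (hNle w)).comp 
          (continuous_subtype_val : Continuous ((↑) : Iic (0 : ℝ) → ℝ))
        have h3 : Continuous fun t : Iic (0 : ℝ) => b t := h1
        have h4 : Continuous fun t : Iic (0 : ℝ) => conv T (N w) t := h2
        have h5 : Continuous fun t : Iic (0 : ℝ) => Real.exp (-η * (t : ℝ)) := by fun_prop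
        exact h5.smul (h3.add h4))
      (C + q * ‖w‖)
      (fun t => by
        rw [norm_smul, Real.norm_of_nonneg (Real.exp_pos _).le]
        have h1 := hT.norm_conv_le hκ (norm_nonneg _) (hNle w) t
        calc _ ≤ Real.exp (-η * t) * (C * Real.exp (η * t) + q * ‖w‖ * Real.exp (η * t)) :=
              mul_le_mul_of_nonneg_left ((norm_add_le _ _).trans (add_le_add (hC t t.2) h1))
                (Real.exp_pos _).le
          _ = (C + q * ‖w‖) * (Real.exp (-η * t) * Real.exp (η * t)) := by ring
          _ = _ := by rw [hexp, mul_one])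
  have hΦ : ∀ w t, Φ w t = Real.exp (-η * t) • (b t + conv T (N w) t) := fun w t => rfl
  have hcontr : ContractingWith ⟨q, hq0⟩ Φ := by
    refine ⟨by exact_mod_cast hq, LipschitzWith.of_dist_le_mul fun w w' => ?_⟩
    refine (BoundedContinuousFunction.dist_le (mul_nonneg hq0 dist_nonneg)).2 fun t => ?_
    rw [hΦ, hΦ, dist_eq_norm, ← smul_sub, add_sub_add_left_eq_sub,
      ← hT.conv_sub hκ (hNc w) (hNle w) (hNc w') (hNle w'), norm_smul,
      Real.norm_of_nonneg (Real.exp_pos _).le]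
    have h1 := hT.norm_conv_le hκ dist_nonneg (hNsub w w') t
    calc _ ≤ Real.exp (-η * t) * (q * dist w w' * Real.exp (η * t)) :=
          mul_le_mul_of_nonneg_left h1 (Real.exp_pos _).le
      _ = q * dist w w' * (Real.exp (-η * t) * Real.exp (η * t)) := by ring
      _ = _ := by rw [hexp, mul_one]
  let w := ContractingWith.fixedPoint Φ hcontr
  have hw : Φ w = w := hcontr.fixedPoint_isFixedPt
  refine ⟨V w, (hVc w).continuousOn, ⟨‖w‖, fun t _ => hVle w t⟩, fun t ht => ?_⟩
  have h1 : V w t = Real.exp (η * t) • w ⟨t, ht⟩ := by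
    simp only [V]; rw [IicExtend_of_mem _ (show t ∈ Iic (0 : ℝ) from ht)]
  rw [h1]
  conv_lhs => rw [← hw]
  rw [hΦ, smul_smul, mul_comm, hexp, one_smul]

end Convolution

/-! ### Differentiable dependence of solutions of convolution equations -/

section ConvolutionEquation

variable {E Z V : Type*} [NormedAddCommGroup E] [NormedSpace ℝ E]
  [NormedAddCommGroup Z] [NormedSpace ℝ Z] [NormedAddCommGroup V] [NormedSpace ℝ V]

/-- `U` solves `U = b + T * F(U)` on the negative half line, and grows at most like `exp (η t)`. -/
structure IsConvSolution (T : ℝ → E →L[ℝ] Z) (F : Z → E) (b : ℝ → Z) (η : ℝ) (U : ℝ → Z) :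
    Prop where
  continuousOn : ContinuousOn U (Iic 0)
  bounded : ∃ C, ∀ t ≤ 0, ‖U t‖ ≤ C * Real.exp (η * t)
  eq : ∀ t ≤ 0, U t = b t + conv T (fun s => F (U s)) t

variable {T : ℝ → E →L[ℝ] Z} {κ : ℝ → ℝ} {η η' : ℝ} {F : Z → E}

theorem exp_mul_le_exp_mul (hη : η ≤ η') {t : ℝ} (ht : t ≤ 0) :
    Real.exp (η' * t) ≤ Real.exp (η * t) :=
  Real.exp_le_exp.2 (mul_le_mul_of_nonpos_right hη ht)

/-- Times are nonpositive, so a larger exponent is a stronger growth condition. -/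
theorem IsConvSolution.mono {b U : ℝ → Z} (hU : IsConvSolution T F b η' U) (hη : η ≤ η') :
    IsConvSolution T F b η U := by
  obtain ⟨h1, ⟨C, hC⟩, h3⟩ := hU
  have hC0 : 0 ≤ C := by simpa using (norm_nonneg _).trans (hC 0 le_rfl)
  exact ⟨h1, ⟨C, fun t ht => (hC t ht).trans
    (mul_le_mul_of_nonneg_left (exp_mul_le_exp_mul hη ht) hC0)⟩, h3⟩

theorem IsConvSolution.congr {b U U' : ℝ → Z} (hU : IsConvSolution T F b η U)
    (h : ∀ t ≤ 0, U' t = U t) :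
    IsConvSolution T F b η U' := by
  obtain ⟨C, hC⟩ := hU.bounded
  refine ⟨hU.continuousOn.congr h, ⟨C, fun t ht => by rw [h t ht]; exact hC t ht⟩, fun t ht => ?_⟩
  rw [h t ht, hU.eq t ht, conv_congr (ψ := fun s => F (U' s)) fun s hs => by rw [h s hs]]

theorem norm_sub_le_of_lipschitzWith_one {E Z : Type*} [NormedAddCommGroup E]
    [NormedAddCommGroup Z] {F : Z → E} (hF : LipschitzWith 1 F) (z z' : Z) :
    ‖F z - F z'‖ ≤ ‖z - z'‖ := by
  simpa using hF.norm_sub_le z z'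

theorem IsConvKernel.exists_convSolution [CompleteSpace Z] (hT : IsConvKernel T κ)
    (hκ : Integrable fun r => κ r * Real.exp (-η * r)) (hq : ∫ r, κ r * Real.exp (-η * r) < 1)
    (hF : LipschitzWith 1 F) (hF0 : F 0 = 0) {b : ℝ → Z} {C : ℝ} (hb : ContinuousOn b (Iic 0))
    (hC : ∀ t ≤ 0, ‖b t‖ ≤ C * Real.exp (η * t)) : ∃ U, IsConvSolution T F b η U := by
  obtain ⟨U, h1, h2, h3⟩ := hT.exists_solution hκ hq (G := fun _ => F)
    (hF.continuous.comp continuous_snd).continuousOn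
    (fun s _ z z' => norm_sub_le_of_lipschitzWith_one hF z z') (fun _ _ => hF0) hb hC
  exact ⟨U, h1, h2, h3⟩

/-- The difference equals b - b' plus the convolution of F(U) - F(U'), which is no larger than U -
U'; hence `norm_le_of_conv` applies with β = 0. The case α = 0 is uniqueness. -/
theorem IsConvKernel.norm_sub_le (hT : IsConvKernel T κ)
    (hκ : Integrable fun r => κ r * Real.exp (-η * r)) (hq : ∫ r, κ r * Real.exp (-η * r) < 1)
    (hF : LipschitzWith 1 F) (hF0 : F 0 = 0) {b b' U U' : ℝ → Z} {α : ℝ}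
    (hU : IsConvSolution T F b η U) (hU' : IsConvSolution T F b' η U')
    (hb : ∀ t ≤ 0, ‖b t - b' t‖ ≤ α * Real.exp (η * t)) {t : ℝ} (ht : t ≤ 0) :
    ‖U t - U' t‖ ≤ α / (1 - ∫ r, κ r * Real.exp (-η * r)) * Real.exp (η * t) := by
  obtain ⟨h1, ⟨C, hC⟩, h3⟩ := hU
  obtain ⟨h1', ⟨C', hC'⟩, h3'⟩ := hU'
  have hle : ∀ z, ‖F z‖ ≤ ‖z‖ := fun z => by
    simpa [hF0] using norm_sub_le_of_lipschitzWith_one hF z 0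
  have := hT.norm_le_of_conv hκ hq (U := fun t => U t - U' t) (C := C + C') (α := α) (β := 0)
    (φ := fun t => F (U t) - F (U' t)) le_rfl
    (fun t ht => (_root_.norm_sub_le _ _).trans
      ((add_le_add (hC t ht) (hC' t ht)).trans_eq (by ring)))
    (fun t _ => by simpa using norm_sub_le_of_lipschitzWith_one hF (U t) (U' t))
    (fun t ht => by
      rw [hT.conv_sub hκ (φ := fun s => F (U s)) (ψ := fun s => F (U' s))
        (hF.continuous.comp_continuousOn h1)
        (fun s hs => (hle _).trans (hC s hs)) (hF.continuous.comp_continuousOn h1')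
        (fun s hs => (hle _).trans (hC' s hs)), h3 t ht, h3' t ht]
      convert hb t ht using 2
      abel) ht
  simpa using this

theorem IsConvKernel.eq_of_isConvSolution (hT : IsConvKernel T κ)
    (hκ : Integrable fun r => κ r * Real.exp (-η * r)) (hq : ∫ r, κ r * Real.exp (-η * r) < 1)
    (hF : LipschitzWith 1 F) (hF0 : F 0 = 0) {b U U' : ℝ → Z}
    (hU : IsConvSolution T F b η U) (hU' : IsConvSolution T F b η U') {t : ℝ} (ht : t ≤ 0) :
    U t = U' t := by
  have := hT.norm_sub_le hκ hq hF hF0 (α := 0) hU hU' (fun t _ => by simp) ht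
  rw [zero_div, zero_mul, norm_le_zero_iff, sub_eq_zero] at this
  exact this

/-- A superposition operator is differentiable if its range space carries a weaker weight. -/
theorem exists_norm_superposition_remainder_le (hF : ContDiff ℝ 1 F) (hFl : LipschitzWith 1 F)
    (hη : η < η') {U : ℝ → Z} (hU : ContinuousOn U (Iic 0)) {c : ℝ} (hc : 0 < c) :
    ∃ d > 0, ∀ m < d, 0 ≤ m → ∀ D : ℝ → Z, (∀ t ≤ 0, ‖D t‖ ≤ m * Real.exp (η' * t)) → ∀ t ≤ 0,
      ‖F (U t + D t) - F (U t) - fderiv ℝ F (U t) (D t)‖ ≤ c * m * Real.exp (η * t) := by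
  have hη0 : 0 < η' - η := sub_pos.2 hη
  -- Before time -τ the gain e^{(η'-η)t} is at most c/2, and the crude bound 2‖D t‖ on the remainder
  -- suffices.
  obtain ⟨τ, hτ0, hτ⟩ : ∃ τ : ℝ, 0 ≤ τ ∧ Real.exp (-((η' - η) * τ)) ≤ c / 2 := by
    refine ⟨max 0 (-Real.log (c / 2) / (η' - η)), le_max_left _ _, ?_⟩
    rw [← Real.exp_log (half_pos hc)]
    refine Real.exp_le_exp.2 ?_
    have := mul_le_mul_of_nonneg_left (le_max_right 0 (-Real.log (c / 2) / (η' - η))) hη0.le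
    rw [mul_div_cancel₀ _ hη0.ne'] at this
    rw [Real.exp_log (half_pos hc)]
    linarith
  -- On [-τ, 0] the path has compact image, near which the derivative varies by less than c within
  -- some distance ρ.
  have hK : IsCompact (U '' Icc (-τ) 0) :=
    isCompact_Icc.image_of_continuousOn (hU.mono fun t ht => ht.2)
  have hcont : Continuous (fderiv ℝ F) := hF.continuous_fderiv one_ne_zero
  obtain ⟨ρ, hρ, hρ'⟩ := Metric.mem_uniformity_dist.1
    (hK.uniformContinuousAt_of_continuousAt (fderiv ℝ F) (fun a _ => hcont.continuousAt)
      (Metric.dist_mem_uniformity hc))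
  have hdiff : Differentiable ℝ F := hF.differentiable one_ne_zero
  have hfd : ∀ z, ‖fderiv ℝ F z‖ ≤ 1 := fun z => by
    simpa using norm_fderiv_le_of_lipschitz ℝ hFl (x₀ := z)
  -- This radius keeps ‖D t‖ below ρ on [-τ, 0].
  refine ⟨ρ / Real.exp (|η'| * τ), by positivity, fun m hm hm0 D hD t ht => ?_⟩
  have hexp := exp_mul_le_exp_mul hη.le ht
  rcases le_or_gt (-τ) t with h | h
  · have hDρ : ‖D t‖ < ρ := by
      refine (hD t ht).trans_lt (lt_of_le_of_lt ?_ ((lt_div_iff₀ (Real.exp_pos _)).1 hm))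
      refine mul_le_mul_of_nonneg_left (Real.exp_le_exp.2 ?_) hm0
      calc η' * t ≤ |η' * t| := le_abs_self _
        _ = |η'| * -t := by rw [abs_mul, abs_of_nonpos ht]
        _ ≤ |η'| * τ := mul_le_mul_of_nonneg_left (by linarith) (abs_nonneg _)
    have hmv := (convex_ball (U t) ρ).norm_image_sub_le_of_norm_fderiv_le' (𝕜 := ℝ) (f := F)
      (C := c) (φ := fderiv ℝ F (U t)) (x := U t) (y := U t + D t)
      (fun x _ => hdiff x) (fun x hx => by
        have := @hρ' (U t) x (by rw [dist_comm]; exact hx) ⟨t, ⟨h, ht⟩, rfl⟩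
        rw [← dist_eq_norm, dist_comm]
        exact le_of_lt this) (Metric.mem_ball_self hρ) (by simpa using hDρ)
    rw [add_sub_cancel_left] at hmv
    calc _ ≤ c * ‖D t‖ := hmv
      _ ≤ c * (m * Real.exp (η * t)) := mul_le_mul_of_nonneg_left
          ((hD t ht).trans (mul_le_mul_of_nonneg_left hexp hm0)) hc.le
      _ = _ := by ring
  · have h1 : ‖F (U t + D t) - F (U t)‖ ≤ ‖D t‖ := by
      simpa using norm_sub_le_of_lipschitzWith_one hFl (U t + D t) (U t)
    have h2 : ‖fderiv ℝ F (U t) (D t)‖ ≤ ‖D t‖ := by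
      simpa using (fderiv ℝ F (U t)).le_of_opNorm_le (hfd _) (D t)
    have h3 : Real.exp (η' * t) ≤ c / 2 * Real.exp (η * t) := by
      refine le_trans ?_ (mul_le_mul_of_nonneg_right hτ (Real.exp_pos _).le)
      rw [← Real.exp_add]
      refine Real.exp_le_exp.2 ?_
      nlinarith
    calc _ ≤ ‖D t‖ + ‖D t‖ := (norm_sub_le _ _).trans (add_le_add h1 h2)
      _ ≤ m * (c / 2 * Real.exp (η * t)) + m * (c / 2 * Real.exp (η * t)) := by
          have := (hD t ht).trans (mul_le_mul_of_nonneg_left h3 hm0)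
          exact add_le_add this this
      _ = _ := by ring

/-- Bounded linear maps defined by the value at time `0` of the solutions of a linear
convolution equation. -/
theorem IsConvKernel.exists_linear_solution [CompleteSpace Z] (hT : IsConvKernel T κ)
    (hκ : Integrable fun r => κ r * Real.exp (-η * r)) (hq : ∫ r, κ r * Real.exp (-η * r) < 1)
    {A : ℝ → Z →L[ℝ] E} (hA : ContinuousOn A (Iic 0)) (hA1 : ∀ s ≤ 0, ‖A s‖ ≤ 1)
    {Λ : ℝ → V →L[ℝ] Z} {C : ℝ} (hΛ : ∀ v, ContinuousOn (fun t => Λ t v) (Iic 0))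
    (hC : ∀ t ≤ 0, ‖Λ t‖ ≤ C * Real.exp (η * t)) :
    ∃ W : V → ℝ → Z, ∃ L : V →L[ℝ] Z, (∀ k, W k 0 = L k) ∧ ∀ k, ContinuousOn (W k) (Iic 0) ∧
      (∃ C', ∀ t ≤ 0, ‖W k t‖ ≤ C' * Real.exp (η * t)) ∧
      ∀ t ≤ 0, W k t = Λ t k + conv T (fun s => A s (W k s)) t := by
  have hAle : ∀ s ≤ 0, ∀ z, ‖A s z‖ ≤ ‖z‖ := fun s hs z => by
    simpa using (A s).le_of_opNorm_le (hA1 s hs) z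
  have hΛle : ∀ k, ∀ t ≤ 0, ‖Λ t k‖ ≤ (C * ‖k‖) * Real.exp (η * t) := fun k t ht => by
    have := (Λ t).le_of_opNorm_le (hC t ht) k
    linarith
  have hex : ∀ k, ∃ U : ℝ → Z, ContinuousOn U (Iic 0) ∧
      (∃ C', ∀ t ≤ 0, ‖U t‖ ≤ C' * Real.exp (η * t)) ∧
      ∀ t ≤ 0, U t = Λ t k + conv T (fun s => A s (U s)) t := fun k =>
    hT.exists_solution hκ hq (G := fun s z => A s z)
      ((hA.comp continuousOn_fst fun p hp => hp.1).clm_apply continuousOn_snd)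
      (fun s hs z z' => by rw [← map_sub]; exact hAle s hs _) (fun s _ => map_zero _)
      (hΛ k) (hΛle k)
  choose W hWc hWb hW using hex
  have hAW : ∀ k, ContinuousOn (fun s => A s (W k s)) (Iic 0) := fun k => hA.clm_apply (hWc k)
  -- The defect of linearity solves the homogeneous equation, so the estimate with α = β = 0 makes
  -- it vanish.
  have hlin : ∀ k l (a : ℝ), W (k + a • l) 0 = W k 0 + a • W l 0 := by
    intro k l a
    obtain ⟨C₁, h₁⟩ := hWb (k + a • l)
    obtain ⟨C₂, h₂⟩ := hWb k
    obtain ⟨C₃, h₃⟩ := hWb l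
    have hs₃ : ∀ t ≤ 0, ‖a • W l t‖ ≤ (‖a‖ * C₃) * Real.exp (η * t) := fun t ht => by
      rw [norm_smul, mul_assoc]
      exact mul_le_mul_of_nonneg_left (h₃ t ht) (norm_nonneg _)
    have key := hT.norm_le_of_conv hκ hq (U := fun t => W (k + a • l) t - W k t - a • W l t)
      (C := C₁ + C₂ + ‖a‖ * C₃) (α := 0) (β := 0)
      (φ := fun t => A t (W (k + a • l) t) - A t (W k t) - A t (a • W l t)) le_rfl
      (fun t ht => (norm_sub_le_of_le (norm_sub_le_of_le (h₁ t ht) (h₂ t ht))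
        (hs₃ t ht)).trans_eq (by ring))
      (fun t ht => by simpa [map_sub] using hAle t ht (W (k + a • l) t - W k t - a • W l t))
      (fun t ht => by
        have e1 := hT.conv_sub hκ (hAW (k + a • l)) (fun s hs => (hAle s hs _).trans (h₁ s hs))
          (hAW k) (fun s hs => (hAle s hs _).trans (h₂ s hs)) t
        have e2 := hT.conv_sub hκ (φ := fun s => A s (W (k + a • l) s) - A s (W k s))
          (ψ := fun s => A s (a • W l s)) ((hAW (k + a • l)).sub (hAW k)) (M := C₁ + C₂)
          (fun s hs => (norm_sub_le_of_le ((hAle s hs _).trans (h₁ s hs))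
            ((hAle s hs _).trans (h₂ s hs))).trans_eq (by ring))
          (hA.clm_apply ((hWc l).const_smul a)) (fun s hs => (hAle s hs _).trans (hs₃ s hs)) t
        have e3 : conv T (fun s => A s (a • W l s)) t = a • conv T (fun s => A s (W l s)) t := by
          simp only [conv, map_smul, integral_smul]
        rw [e2, e1, e3, hW _ t ht, hW k t ht, hW l t ht, map_add, map_smul, smul_add, zero_mul,
          norm_le_zero_iff]
        abel) le_rfl
    rw [zero_add, mul_zero, zero_div, zero_mul, norm_le_zero_iff] at key
    rw [sub_sub, sub_eq_zero] at key
    exact key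
  have hW0 : W 0 0 = 0 := by simpa using hlin 0 0 (-1)
  let L₀ : V →ₗ[ℝ] Z :=
    { toFun := fun k => W k 0
      map_add' := fun k l => by simpa using hlin k l 1
      map_smul' := fun a l => by simpa [hW0] using hlin 0 l a }
  refine ⟨W, L₀.mkContinuous (C / (1 - ∫ r, κ r * Real.exp (-η * r))) fun k => ?_, fun k => rfl,
    fun k => ⟨hWc k, hWb k, hW k⟩⟩
  obtain ⟨C', hC'⟩ := hWb k
  have key := hT.norm_le_of_conv hκ hq (U := W k) (α := C * ‖k‖) (β := 0)
    (φ := fun t => A t (W k t)) le_rfl hC' (fun t ht => by simpa using hAle t ht (W k t))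
    (fun t ht => by
      rw [sub_eq_of_eq_add (hW k t ht)]
      exact hΛle k t ht) le_rfl
  calc ‖W k 0‖ ≤ _ := key
    _ = _ := by rw [mul_zero, mul_zero, Real.exp_zero, add_zero, mul_one]; ring

/-- Two weights are needed: differences of solutions are measured with the stronger exponent `η'`,
the linearisation and its error with the weaker `η`. -/
theorem IsConvKernel.differentiable_solution [CompleteSpace Z] (hT : IsConvKernel T κ)
    (hη : η < η')
    (hκ : Integrable fun r => κ r * Real.exp (-η * r)) (hq : ∫ r, κ r * Real.exp (-η * r) < 1)
    (hκ' : Integrable fun r => κ r * Real.exp (-η' * r))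
    (hq' : ∫ r, κ r * Real.exp (-η' * r) < 1)
    (hF : ContDiff ℝ 1 F) (hFl : LipschitzWith 1 F) (hF0 : F 0 = 0)
    {Λ : ℝ → V →L[ℝ] Z} {C : ℝ} (hΛ : ∀ v, ContinuousOn (fun t => Λ t v) (Iic 0))
    (hC : ∀ t ≤ 0, ‖Λ t‖ ≤ C * Real.exp (η' * t))
    {U : V → ℝ → Z} (hU : ∀ v, IsConvSolution T F (fun t => Λ t v) η (U v)) :
    Differentiable ℝ fun v => U v 0 := by
  set q := ∫ r, κ r * Real.exp (-η * r)
  set q' := ∫ r, κ r * Real.exp (-η' * r)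
  have hq0 : 0 ≤ q := hT.integral_nonneg
  have hC0 : 0 ≤ C := by simpa using (norm_nonneg _).trans (hC 0 le_rfl)
  have hΛle : ∀ k, ∀ t ≤ 0, ‖Λ t k‖ ≤ (C * ‖k‖) * Real.exp (η' * t) := fun k t ht => by
    have := (Λ t).le_of_opNorm_le (hC t ht) k
    linarith
  -- A solution built at the stronger weight is also one at the weaker weight, where uniqueness
  -- identifies it with `U v`.
  have hU' : ∀ v, IsConvSolution T F (fun t => Λ t v) η' (U v) := fun v => by
    obtain ⟨U', h'⟩ := hT.exists_convSolution hκ' hq' hFl hF0 (hΛ v) (hΛle v)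
    have heq : ∀ t ≤ 0, U v t = U' t := fun t ht =>
      hT.eq_of_isConvSolution hκ hq hFl hF0 (hU v) (h'.mono hη.le) ht
    obtain ⟨C', hC'⟩ := h'.bounded
    exact ⟨(hU v).continuousOn, ⟨C', fun t ht => by rw [heq t ht]; exact hC' t ht⟩, (hU v).eq⟩
  intro v
  have hfd : ∀ z, ‖fderiv ℝ F z‖ ≤ 1 := fun z => by
    simpa using norm_fderiv_le_of_lipschitz ℝ hFl (x₀ := z)
  have hA : ContinuousOn (fun s => fderiv ℝ F (U v s)) (Iic 0) :=
    (hF.continuous_fderiv one_ne_zero).comp_continuousOn (hU v).continuousOn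
  obtain ⟨W, L, hWL, hW⟩ := hT.exists_linear_solution hκ hq hA (fun s _ => hfd _) hΛ
    (fun t ht => (hC t ht).trans (mul_le_mul_of_nonneg_left (exp_mul_le_exp_mul hη.le ht) hC0))
  refine HasFDerivAt.differentiableAt (f' := L) ?_
  rw [hasFDerivAt_iff_isLittleO_nhds_zero, Asymptotics.isLittleO_iff]
  intro c hc
  set C' := C / (1 - q')
  have hC'0 : 0 ≤ C' := div_nonneg hC0 (by linarith)
  -- Chosen so that c₀ C'‖k‖ / (1 - q) ≤ c‖k‖; the extra 1 avoids division by zero when C' = 0.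
  set c₀ := c * (1 - q) / (C' + 1)
  have hc₀ : 0 < c₀ := div_pos (mul_pos hc (by linarith)) (by linarith)
  obtain ⟨d, hd, hrem⟩ := exists_norm_superposition_remainder_le hF hFl hη (hU v).continuousOn hc₀
  filter_upwards [Metric.ball_mem_nhds (0 : V) (show 0 < d / (C' + 1) by positivity)] with k hk
  rw [mem_ball_zero_iff, lt_div_iff₀ (by positivity)] at hk
  set m := C' * ‖k‖
  have hm0 : 0 ≤ m := by positivity
  have hmd : m < d := by
    have := norm_nonneg k
    simp only [m]; nlinarith
  have hD : ∀ t ≤ 0, ‖U (v + k) t - U v t‖ ≤ m * Real.exp (η' * t) := fun t ht => by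
    have := hT.norm_sub_le hκ' hq' hFl hF0 (hU' (v + k)) (hU' v) (α := C * ‖k‖)
      (fun t ht => by rw [← map_sub, add_sub_cancel_left]; exact hΛle k t ht) ht
    refine this.trans_eq ?_
    simp only [m, C', q']
    ring
  have hβ : ∀ t ≤ 0, ‖F (U (v + k) t) - F (U v t) - fderiv ℝ F (U v t) (U (v + k) t - U v t)‖ ≤
      c₀ * m * Real.exp (η * t) := fun t ht => by
    have := hrem m hmd hm0 (fun t => U (v + k) t - U v t) hD t ht
    rwa [add_sub_cancel] at this
  obtain ⟨hWc, ⟨C₃, h₃⟩, hWeq⟩ := hW k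
  obtain ⟨C₁, h₁⟩ := (hU (v + k)).bounded
  obtain ⟨C₂, h₂⟩ := (hU v).bounded
  have hFle : ∀ z, ‖F z‖ ≤ ‖z‖ := fun z => by
    simpa [hF0] using norm_sub_le_of_lipschitzWith_one hFl z 0
  have hAle : ∀ y z, ‖fderiv ℝ F y z‖ ≤ ‖z‖ := fun y z => by
    simpa using (fderiv ℝ F y).le_of_opNorm_le (hfd y) z
  have hFc : ∀ w, ContinuousOn (fun s => F (U w s)) (Iic 0) := fun w =>
    hFl.continuous.comp_continuousOn (hU w).continuousOn
  -- The error R satisfies R = T * (F'(U)R + remainder), so it is controlled by the size c₀m of the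
  -- remainder.
  have key := hT.norm_le_of_conv hκ hq (U := fun t => U (v + k) t - U v t - W k t)
    (C := C₁ + C₂ + C₃) (α := 0) (β := c₀ * m)
    (φ := fun t => F (U (v + k) t) - F (U v t) - fderiv ℝ F (U v t) (W k t)) (by positivity)
    (fun t ht => (norm_sub_le_of_le (norm_sub_le_of_le (h₁ t ht) (h₂ t ht))
      (h₃ t ht)).trans_eq (by ring))
    (fun t ht => by
      have e : F (U (v + k) t) - F (U v t) - fderiv ℝ F (U v t) (W k t) =
          fderiv ℝ F (U v t) (U (v + k) t - U v t - W k t) +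
          (F (U (v + k) t) - F (U v t) - fderiv ℝ F (U v t) (U (v + k) t - U v t)) := by
        rw [map_sub (fderiv ℝ F (U v t)) (U (v + k) t - U v t)]; abel
      rw [e]
      exact norm_add_le_of_le (hAle _ _) (hβ t ht))
    (fun t ht => by
      have e1 := hT.conv_sub hκ (hFc (v + k)) (fun s hs => (hFle _).trans (h₁ s hs))
        (hFc v) (fun s hs => (hFle _).trans (h₂ s hs)) t
      have e2 := hT.conv_sub hκ (φ := fun s => F (U (v + k) s) - F (U v s))
        (ψ := fun s => fderiv ℝ F (U v s) (W k s)) ((hFc (v + k)).sub (hFc v)) (M := C₁ + C₂)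
        (fun s hs => (norm_sub_le_of_le ((hFle _).trans (h₁ s hs))
          ((hFle _).trans (h₂ s hs))).trans_eq (by ring))
        (hA.clm_apply hWc) (fun s hs => (hAle _ _).trans (h₃ s hs)) t
      rw [e2, e1, (hU (v + k)).eq t ht, (hU v).eq t ht, hWeq t ht, map_add, zero_mul,
        norm_le_zero_iff]
      abel) le_rfl
  rw [← hWL]
  refine key.trans ?_
  rw [mul_zero, Real.exp_zero, mul_one, zero_add, div_le_iff₀ (by linarith)]
  have hc₀m : c₀ * m ≤ c * (1 - q) * ‖k‖ := by
    have : c₀ * (C' + 1) = c * (1 - q) := div_mul_cancel₀ _ (by positivity)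
    rw [← this]
    have : C' * ‖k‖ ≤ (C' + 1) * ‖k‖ := by nlinarith [norm_nonneg k]
    calc c₀ * m ≤ c₀ * ((C' + 1) * ‖k‖) := mul_le_mul_of_nonneg_left this hc₀.le
      _ = _ := by ring
  calc q * (c₀ * m) ≤ 1 * (c₀ * m) := mul_le_mul_of_nonneg_right hq.le (by positivity)
    _ ≤ _ := by rw [one_mul]; linarith

end ConvolutionEquation

/-! ### Strongly continuous families of operators -/

section StrongContinuity

variable {E E₁ F : Type*} [NormedAddCommGroup E] [NormedSpace ℝ E]
  [NormedAddCommGroup E₁] [NormedSpace ℝ E₁] [NormedAddCommGroup F] [NormedSpace ℝ F]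

/-- A locally bounded family of operators that is strongly continuous on a dense set is jointly
continuous. -/
theorem continuousOn_uncurry_of_dense {T : ℝ → E →L[ℝ] F} {s : Set ℝ} {D : Set E} (hD : Dense D)
    (hT : ∀ x ∈ D, ContinuousOn (fun r => T r x) s)
    (hb : ∀ r ∈ s, ∃ M, ∀ᶠ r' in 𝓝[s] r, ‖T r'‖ ≤ M) :
    ContinuousOn (fun p : ℝ × E => T p.1 p.2) (s ×ˢ univ) := by
  rintro ⟨r₀, x₀⟩ ⟨hr₀, -⟩
  obtain ⟨M, hM⟩ := hb r₀ hr₀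
  have hM₀ : ‖T r₀‖ ≤ M := hM.self_of_nhdsWithin hr₀
  have hM0 : 0 ≤ M := (norm_nonneg _).trans hM₀
  rw [ContinuousWithinAt, Metric.tendsto_nhds]
  intro e he
  -- Three of the four error terms below are at most M d < e/4.
  set d := e / (4 * (M + 1))
  have hd : 0 < d := by positivity
  have hMd : M * d < e / 4 := by
    have : (M + 1) * d = e / 4 := by simp only [d]; field_simp
    nlinarith
  obtain ⟨y, hyD, hy⟩ := hD.exists_dist_lt x₀ hd
  rw [nhdsWithin_prod_eq, nhdsWithin_univ]
  have h1 : ∀ᶠ p : ℝ × E in 𝓝[s] r₀ ×ˢ 𝓝 x₀, ‖T p.1‖ ≤ M := tendsto_fst.eventually hM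
  have h2 : ∀ᶠ p : ℝ × E in 𝓝[s] r₀ ×ˢ 𝓝 x₀, dist p.2 x₀ < d :=
    tendsto_snd.eventually (Metric.ball_mem_nhds x₀ hd)
  have h3 : ∀ᶠ p : ℝ × E in 𝓝[s] r₀ ×ˢ 𝓝 x₀, dist (T p.1 y) (T r₀ y) < e / 4 :=
    tendsto_fst.eventually (Metric.tendsto_nhds.1 (hT y hyD r₀ hr₀) _ (by positivity))
  filter_upwards [h1, h2, h3] with p h1 h2 h3
  rw [dist_eq_norm] at *
  have e1 : T p.1 p.2 - T r₀ x₀ = T p.1 (p.2 - x₀) + T p.1 (x₀ - y) + (T p.1 y - T r₀ y) +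
      T r₀ (y - x₀) := by simp only [map_sub]; abel
  have b1 := (T p.1).le_of_opNorm_le_of_le h1 h2.le
  have b2 := (T p.1).le_of_opNorm_le_of_le h1 hy.le
  have b3 := (T r₀).le_of_opNorm_le_of_le hM₀ (norm_sub_rev x₀ y ▸ hy.le)
  rw [e1]
  refine (norm_add_le_of_le (norm_add_le_of_le (norm_add_le_of_le b1 b2) h3.le) b3).trans_lt ?_
  linarith

/-- Operators with values in a smaller space, which satisfy a norm bound there and are strongly
continuous on a dense set, form a strongly continuous family. -/
theorem exists_smoothing_family {ι : F →L[ℝ] E₁} (hι : Function.Injective ι)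
    {P : ℝ → E →L[ℝ] E₁} {s : Set ℝ} {k : ℝ → ℝ} (hk : ContinuousOn k s) (hk0 : ∀ r ∈ s, 0 ≤ k r)
    (hP : ∀ r ∈ s, ∀ x, ∃ z, ι z = P r x ∧ ‖z‖ ≤ k r * ‖x‖) {D : Set E} (hD : Dense D)
    (hc : ∀ x ∈ D, ∃ c : ℝ → F, ContinuousOn c s ∧ ∀ r ∈ s, ι (c r) = P r x) :
    ∃ T : ℝ → E →L[ℝ] F, (∀ r ∈ s, ∀ x, ι (T r x) = P r x) ∧ (∀ r ∈ s, ‖T r‖ ≤ k r) ∧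
      ContinuousOn (fun p : ℝ × E => T p.1 p.2) (s ×ˢ univ) := by
  have hex : ∀ r, ∃ T : E →L[ℝ] F, r ∈ s → (∀ x, ι (T x) = P r x) ∧ ‖T‖ ≤ k r := by
    intro r
    by_cases hr : r ∈ s
    · choose z hz hzn using hP r hr
      let T₀ : E →ₗ[ℝ] F :=
        { toFun := z
          map_add' := fun x y => hι (by rw [map_add, hz, hz, hz, map_add])
          map_smul' := fun a x => hι (by simp [hz]) }
      exact ⟨T₀.mkContinuous (k r) hzn, fun _ => ⟨hz, T₀.mkContinuous_norm_le (hk0 r hr) _⟩⟩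
    · exact ⟨0, fun h => absurd h hr⟩
  choose T hT using hex
  refine ⟨T, fun r hr => (hT r hr).1, fun r hr => (hT r hr).2,
    continuousOn_uncurry_of_dense hD (fun x hx => ?_) fun r hr => ⟨k r + 1, ?_⟩⟩
  · obtain ⟨c, hc1, hc2⟩ := hc x hx
    exact hc1.congr fun r hr => hι (by rw [(hT r hr).1, hc2 r hr])
  · filter_upwards [(hk r hr).eventually (gt_mem_nhds (lt_add_one (k r))), self_mem_nhdsWithin]
      with r' h1 h2
    exact ((hT r' h2).2).trans h1.le

end StrongContinuity

/-! ### Semigroups and the domains of their generators -/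

section SemigroupLemmas

variable {E E₁ : Type*} [NormedAddCommGroup E] [NormedSpace ℝ E]
  [NormedAddCommGroup E₁] [NormedSpace ℝ E₁] {S : ℝ → E →L[ℝ] E} {B : E →ₗ.[ℝ] E}

theorem IsC0Semigroup.tendsto_nhdsGE (hS : IsC0Semigroup S) (x : E) :
    Tendsto (fun t => S t x) (𝓝[≥] 0) (𝓝 x) := by
  rw [← Ioi_insert, nhdsWithin_insert, tendsto_sup]
  refine ⟨?_, hS.tendsto_zero x⟩
  rw [tendsto_pure_left]
  intro s hs
  simpa [hS.map_zero] using mem_of_mem_nhds hs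

theorem IsC0Semigroup.apply_add (hS : IsC0Semigroup S) {s t : ℝ} (hs : 0 ≤ s) (ht : 0 ≤ t)
    (x : E) : S (s + t) x = S s (S t x) := by
  rw [hS.map_add s t hs ht]; rfl

/-- If the norms were unbounded near 0, times t_n → 0 with ‖S t_n‖ > n would contradict
Banach–Steinhaus, as S t_n x → x. The semigroup law carries the bound to longer intervals. -/
theorem IsC0Semigroup.exists_norm_le [CompleteSpace E] (hS : IsC0Semigroup S) (b : ℝ) :
    ∃ M, ∀ t, 0 ≤ t → t ≤ b → ‖S t‖ ≤ M := by
  obtain ⟨d, hd, M, hM⟩ : ∃ d > 0, ∃ M, ∀ t, 0 ≤ t → t ≤ d → ‖S t‖ ≤ M := by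
    by_contra! h
    choose t ht0 ht1 htn using fun n : ℕ => h (1 / ((n : ℝ) + 1)) (by positivity) n
    have htend : Tendsto t atTop (𝓝[≥] 0) := tendsto_nhdsWithin_iff.2
      ⟨squeeze_zero ht0 ht1 tendsto_one_div_add_atTop_nhds_zero_nat, Eventually.of_forall ht0⟩
    obtain ⟨C, hC⟩ := banach_steinhaus (g := fun n => S (t n)) fun x => by
      obtain ⟨C, hC⟩ := (Metric.isBounded_range_of_tendsto _
        ((hS.tendsto_nhdsGE x).comp htend)).exists_norm_le
      exact ⟨C, fun n => hC _ ⟨n, rfl⟩⟩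
    obtain ⟨n, hn⟩ := exists_nat_gt C
    exact absurd ((htn n).trans_le (hC n)) (not_lt.2 hn.le)
  have hstep : ∀ n : ℕ, ∃ M, ∀ t, 0 ≤ t → t ≤ n * d → ‖S t‖ ≤ M := by
    intro n
    induction n with
    | zero => exact ⟨M, fun t h0 h1 => hM t h0 (by simp at h1; linarith)⟩
    | succ n ih =>
      obtain ⟨M', hM'⟩ := ih
      refine ⟨max M (M' * M), fun t h0 h1 => ?_⟩
      rcases le_or_gt t d with h | h
      · exact (hM t h0 h).trans (le_max_left _ _)
      · have h2 : S t = S (t - d) * S d := by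
          rw [← hS.map_add _ _ (by linarith) hd.le, sub_add_cancel]
        push_cast at h1
        have h3 := hM' (t - d) (by linarith) (by linarith)
        rw [h2]
        exact ((norm_mul_le _ _).trans (mul_le_mul h3 (hM d hd.le le_rfl) (norm_nonneg _)
          ((norm_nonneg _).trans h3))).trans (le_max_right _ _)
  obtain ⟨n, hn⟩ := exists_nat_gt (b / d)
  obtain ⟨M', hM'⟩ := hstep n
  exact ⟨M', fun t h0 h1 => hM' t h0 (h1.trans ((div_lt_iff₀ hd).1 hn).le)⟩

/-- For s ≤ r, S r x - S s x = S s (S (r - s) x - x) with ‖S s‖ locally bounded; factoring out the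
smaller time gives left continuity too. -/
theorem IsC0Semigroup.continuousOn [CompleteSpace E] (hS : IsC0Semigroup S) (x : E) :
    ContinuousOn (fun t => S t x) (Ici 0) := by
  intro t ht
  obtain ⟨M, hM⟩ := hS.exists_norm_le (t + 1)
  have key : ∀ s r, 0 ≤ s → s ≤ r → s ≤ t + 1 → ‖S r x - S s x‖ ≤ M * ‖S (r - s) x - x‖ := by
    intro s r hs hsr hst
    have h1 : S r x = S s (S (r - s) x) := by
      rw [← hS.apply_add hs (sub_nonneg.2 hsr), add_sub_cancel]
    rw [h1, ← map_sub]
    exact (S s).le_of_opNorm_le (hM s hs hst) _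
  have habs : Tendsto (fun s : ℝ => |s - t|) (𝓝[Ici 0] t) (𝓝[≥] 0) := by
    refine tendsto_nhdsWithin_iff.2 ⟨?_, Eventually.of_forall fun s => mem_Ici.2 (abs_nonneg _)⟩
    have : Tendsto (fun s : ℝ => |s - t|) (𝓝 t) (𝓝 |t - t|) :=
      (Continuous.tendsto (by fun_prop) t)
    rw [sub_self, abs_zero] at this
    exact this.mono_left nhdsWithin_le_nhds
  rw [ContinuousWithinAt, tendsto_iff_norm_sub_tendsto_zero]
  have h0 : Tendsto (fun s => M * ‖S |s - t| x - x‖) (𝓝[Ici 0] t) (𝓝 0) := by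
    have h1 := (hS.tendsto_nhdsGE x).comp habs
    have h2 := (tendsto_iff_norm_sub_tendsto_zero.1 h1).const_mul M
    rwa [mul_zero] at h2
  refine squeeze_zero' (Eventually.of_forall fun _ => norm_nonneg _) ?_ h0
  filter_upwards [self_mem_nhdsWithin, mem_nhdsWithin_of_mem_nhds (gt_mem_nhds (lt_add_one t))]
    with s hs hst
  rcases le_total s t with h | h
  · rw [abs_of_nonpos (sub_nonpos.2 h), neg_sub, norm_sub_rev]
    exact key s t hs h hst.le
  · rw [abs_of_nonneg (sub_nonneg.2 h)]
    exact key t s ht h (by linarith)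

theorem IsC0Semigroup.continuousOn_uncurry [CompleteSpace E] (hS : IsC0Semigroup S) :
    ContinuousOn (fun p : ℝ × E => S p.1 p.2) (Ici 0 ×ˢ univ) := by
  refine continuousOn_uncurry_of_dense dense_univ (fun x _ => hS.continuousOn x) fun r hr => ?_
  obtain ⟨M, hM⟩ := hS.exists_norm_le (r + 1)
  refine ⟨M, ?_⟩
  filter_upwards [self_mem_nhdsWithin, mem_nhdsWithin_of_mem_nhds (gt_mem_nhds (lt_add_one r))]
    with s hs hst
  exact hM s hs hst.le

theorem IsC0Group.continuous (hS : IsC0Group S) (x : E) : Continuous fun t => S t x := by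
  rw [continuous_iff_continuousAt]
  intro t
  have h1 : Tendsto (fun s : ℝ => s - t) (𝓝 t) (𝓝 0) := by
    have : Tendsto (fun s : ℝ => s - t) (𝓝 t) (𝓝 (t - t)) := Continuous.tendsto (by fun_prop) t
    rwa [sub_self] at this
  have h2 := ((S t).continuous.tendsto x).comp ((hS.tendsto_zero x).comp h1)
  refine h2.congr fun s => ?_
  change S t (S (s - t) x) = S s x
  rw [← mul_apply_eq_comp, ← hS.map_add, add_sub_cancel]

theorem Generates.apply_mem_graph (hB : Generates B S) {x y : E} (h : (x, y) ∈ B.graph) {t : ℝ}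
    (ht : 0 ≤ t) : (S t x, S t y) ∈ B.graph := by
  rw [hB.2] at h ⊢
  refine (((S t).continuous.tendsto y).comp h).congr' ?_
  filter_upwards [self_mem_nhdsWithin] with r hr
  have hr : 0 ≤ r := le_of_lt hr
  change S t (r⁻¹ • (S r x - x)) = _
  rw [map_smul, map_sub, ← hB.1.apply_add ht hr, ← hB.1.apply_add hr ht, add_comm]

theorem GeneratesGroup.apply_mem_graph (hB : GeneratesGroup B S) {x y : E} (h : (x, y) ∈ B.graph)
    (t : ℝ) : (S t x, S t y) ∈ B.graph := by
  rw [hB.2] at h ⊢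
  refine (((S t).continuous.tendsto y).comp h).congr fun r => ?_
  change S t (r⁻¹ • (S r x - x)) = _
  rw [map_smul, map_sub, ← mul_apply_eq_comp, ← mul_apply_eq_comp,
    ← hB.1.map_add, ← hB.1.map_add, add_comm]

theorem IsDomainSpace.exists_mem_graph {ι : E₁ →L[ℝ] E} (hι : IsDomainSpace B ι) (x : E₁) :
    ∃ y, (ι x, y) ∈ B.graph :=
  LinearPMap.mem_domain_iff.1 ((hι.mem_domain_iff _).2 ⟨x, rfl⟩)

theorem IsDomainSpace.exists_eq {ι : E₁ →L[ℝ] E} (hι : IsDomainSpace B ι) {x y : E}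
    (h : (x, y) ∈ B.graph) : ∃ x₁, ι x₁ = x :=
  (hι.mem_domain_iff _).1 (LinearPMap.mem_domain_iff.2 ⟨y, h⟩)

/-- In the graph norm, a path is continuous as soon as it and its image under the generator are
continuous in `E`. -/
theorem IsDomainSpace.continuousOn_of_graph {ι : E₁ →L[ℝ] E} (hι : IsDomainSpace B ι) {s : Set ℝ}
    {c : ℝ → E₁} {y : ℝ → E} (hc : ContinuousOn (fun t => ι (c t)) s) (hy : ContinuousOn y s)
    (h : ∀ t ∈ s, (ι (c t), y t) ∈ B.graph) : ContinuousOn c s := by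
  obtain ⟨a, _, ha, hle⟩ := hι.norm_equiv
  intro t ht
  rw [ContinuousWithinAt, tendsto_iff_norm_sub_tendsto_zero]
  have h0 : Tendsto (fun r => a⁻¹ * (‖ι (c r) - ι (c t)‖ + ‖y r - y t‖)) (𝓝[s] t) (𝓝 0) := by
    have := ((tendsto_iff_norm_sub_tendsto_zero.1 (hc t ht)).add
      (tendsto_iff_norm_sub_tendsto_zero.1 (hy t ht))).const_mul a⁻¹
    rwa [add_zero, mul_zero] at this
  refine squeeze_zero' (Eventually.of_forall fun _ => norm_nonneg _) ?_ h0
  filter_upwards [self_mem_nhdsWithin] with r hr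
  have h1 : (ι (c r - c t), y r - y t) ∈ B.graph := by
    rw [map_sub]; exact B.graph.sub_mem (h r hr) (h t ht)
  have h2 := (hle _ _ h1).1
  rw [map_sub] at h2
  rwa [inv_mul_eq_div, le_div_iff₀' ha]

theorem Generates.exists_lift [CompleteSpace E] (hB : Generates B S) {ι : E₁ →L[ℝ] E}
    (hι : IsDomainSpace B ι) (x : E₁) :
    ∃ c : ℝ → E₁, ContinuousOn c (Ici 0) ∧ ∀ t ≥ 0, ι (c t) = S t (ι x) := by
  obtain ⟨y, hy⟩ := hι.exists_mem_graph x
  have hex : ∀ t : ℝ, ∃ z, 0 ≤ t → ι z = S t (ι x) := fun t => by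
    by_cases ht : 0 ≤ t
    · obtain ⟨z, hz⟩ := hι.exists_eq (hB.apply_mem_graph hy ht)
      exact ⟨z, fun _ => hz⟩
    · exact ⟨0, fun h => absurd h ht⟩
  choose c hc using hex
  refine ⟨c, hι.continuousOn_of_graph (y := fun t => S t y) ?_ (hB.1.continuousOn y) ?_, hc⟩
  · exact (hB.1.continuousOn (ι x)).congr fun t ht => hc t ht
  · intro t ht
    rw [hc t ht]
    exact hB.apply_mem_graph hy ht

/-- A bounded operator that commutes with the generator commutes with the semigroup. -/
theorem Generates.commute [CompleteSpace E] (hB : Generates B S)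
    (hdense : Dense (B.domain : Set E)) {p : E →L[ℝ] E}
    (hp : ∀ x y, (x, y) ∈ B.graph → (p x, p y) ∈ B.graph) {t : ℝ} (ht : 0 ≤ t) (x : E) :
    p (S t x) = S t (p x) := by
  suffices h : (fun x => p (S t x)) = fun x => S t (p x) from congrFun h x
  refine Continuous.ext_on hdense (by fun_prop) (by fun_prop) fun x hx => ?_
  obtain ⟨y, hxy⟩ := LinearPMap.mem_domain_iff.1 hx
  obtain ⟨M, hM⟩ := hB.1.exists_norm_le t
  -- This path runs from S t (p x) at s = 0 to p (S t x) at s = t; its right derivative vanishes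
  -- because `p` commutes with the generator.
  have hconst := constant_of_has_deriv_right_zero (f := fun s => S (t - s) (p (S s x)))
    (a := 0) (b := t) ?_ ?_ t ⟨ht, le_rfl⟩
  · simpa [hB.1.map_zero] using hconst
  · refine hB.1.continuousOn_uncurry.comp (f := fun s => (t - s, p (S s x))) ?_ ?_
    · exact ContinuousOn.prodMk (by fun_prop) (p.continuous.comp_continuousOn
        ((hB.1.continuousOn x).mono fun s hs => hs.1))
    · intro s hs
      exact ⟨sub_nonneg.2 hs.2, mem_univ _⟩
  · intro s hs
    rw [← hasDerivWithinAt_Ioi_iff_Ici,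
      hasDerivWithinAt_iff_tendsto_slope' (by simp), tendsto_zero_iff_norm_tendsto_zero]
    have hsub : Tendsto (fun r : ℝ => r - s) (𝓝[>] s) (𝓝[>] 0) := by
      refine tendsto_nhdsWithin_iff.2 ⟨?_, ?_⟩
      · have : Tendsto (fun r : ℝ => r - s) (𝓝 s) (𝓝 (s - s)) :=
          Continuous.tendsto (by fun_prop) s
        rw [sub_self] at this
        exact this.mono_left nhdsWithin_le_nhds
      · filter_upwards [self_mem_nhdsWithin] with r hr
        exact mem_Ioi.2 (sub_pos.2 (mem_Ioi.1 hr))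
    have hz := hB.apply_mem_graph hxy hs.1
    set z := S s x
    set w := S s y
    have h1 := ((p.continuous.tendsto w).comp ((hB.2 _ _).1 hz)).comp hsub
    have h2 := ((hB.2 _ _).1 (hp _ _ hz)).comp hsub
    have h3 := ((h1.sub h2).norm).const_mul M
    rw [sub_self, norm_zero, mul_zero] at h3
    refine squeeze_zero' (Eventually.of_forall fun _ => norm_nonneg _) ?_ h3
    filter_upwards [self_mem_nhdsWithin, mem_nhdsWithin_of_mem_nhds (gt_mem_nhds hs.2)]
      with r hr hrt
    have hr' : 0 ≤ r - s := sub_nonneg.2 (le_of_lt hr)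
    have e1 : S r x = S (r - s) z := by
      rw [← hB.1.apply_add hr' hs.1, sub_add_cancel]
    have e2 : S (t - s) (p z) = S (t - r) (S (r - s) (p z)) := by
      rw [← hB.1.apply_add (by linarith) hr', sub_add_sub_cancel]
    -- The outer factor is bounded by `M`, and both difference quotients inside tend to p w.
    have e3 : slope (fun s => S (t - s) (p (S s x))) s r = S (t - r)
        (p ((r - s)⁻¹ • (S (r - s) z - z)) - (r - s)⁻¹ • (S (r - s) (p z) - p z)) := by
      rw [slope_def_module]
      change _ • (S (t - r) (p (S r x)) - S (t - s) (p z)) = _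
      rw [e1, e2]
      simp only [map_sub, map_smul, smul_sub]
      abel
    rw [e3]
    exact (S (t - r)).le_of_opNorm_le (hM _ (by linarith) (by linarith [hs.1, mem_Ioi.1 hr])) _

end SemigroupLemmas

/-! ### Operators attached to a splitting -/

section DomainLemmas

variable {E E₁ : Type*} [NormedAddCommGroup E] [NormedSpace ℝ E]
  [NormedAddCommGroup E₁] [NormedSpace ℝ E₁] {S : ℝ → E →L[ℝ] E} {B : E →ₗ.[ℝ] E}

theorem IsDomainSpace.exists_restrict {ι : E₁ →L[ℝ] E} (hι : IsDomainSpace B ι) {p : E →L[ℝ] E}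
    (hp : ∀ x y, (x, y) ∈ B.graph → (p x, p y) ∈ B.graph) :
    ∃ p₁ : E₁ →L[ℝ] E₁, ∀ x, ι (p₁ x) = p (ι x) := by
  choose y hy using hι.exists_mem_graph
  choose z hz using fun x => hι.exists_eq (hp _ _ (hy x))
  obtain ⟨a, C, ha, hle⟩ := hι.norm_equiv
  let p₀ : E₁ →ₗ[ℝ] E₁ :=
    { toFun := z
      map_add' := fun x y => hι.injective (by rw [map_add, hz, hz, hz, map_add, map_add])
      map_smul' := fun a x => hι.injective (by simp [hz]) }
  refine ⟨p₀.mkContinuous (a⁻¹ * (‖p‖ * C)) fun x => ?_, hz⟩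
  have h1 := (hle (z x) (p (y x)) (by rw [hz]; exact hp _ _ (hy x))).1
  have h2 := (hle x (y x) (hy x)).2
  rw [mul_assoc, inv_mul_eq_div, le_div_iff₀' ha]
  calc a * ‖z x‖ ≤ ‖p (ι x)‖ + ‖p (y x)‖ := by rw [← hz]; exact h1
    _ ≤ ‖p‖ * ‖ι x‖ + ‖p‖ * ‖y x‖ := add_le_add (p.le_opNorm _) (p.le_opNorm _)
    _ ≤ ‖p‖ * (C * ‖x‖) := by
        rw [← mul_add]; exact mul_le_mul_of_nonneg_left h2 (norm_nonneg _)
    _ = _ := by ring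

theorem IsDomainSpace.dense_domain {Eθ : Type*} [NormedAddCommGroup Eθ] [NormedSpace ℝ Eθ]
    {θ : ℝ} {ι₁ : E₁ →L[ℝ] E} {j : E₁ →L[ℝ] Eθ} {ι : Eθ →L[ℝ] E} (hι : IsDomainSpace B ι₁)
    (hs : IsScaleSpace θ ι₁ j ι) : Dense (B.domain : Set E) := by
  have h : DenseRange (fun x => ι (j x)) := hs.dense_right.comp hs.dense_left ι.continuous
  refine Dense.mono ?_ h
  rintro _ ⟨x, rfl⟩
  exact (hι.mem_domain_iff _).2 ⟨x, (hs.comp_eq x).symm⟩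

theorem one_mem_sector {θ : ℝ} (hθ : 0 < θ) : (1 : ℂ) ∈ sector θ :=
  ⟨one_ne_zero, by simpa using hθ⟩

/-- A holomorphic semigroup maps into the domain of its generator. -/
theorem IsHolomorphicSemigroup.exists_mem_graph (hS : IsHolomorphicSemigroup S)
    (hB : Generates B S) (x : E) : ∃ y, (S 1 x, y) ∈ B.graph := by
  obtain ⟨θ, hθ, -, P, Q, hPS, -, hder, -⟩ := hS
  obtain ⟨P', Q', hP, -⟩ := hder 1 (one_mem_sector hθ)
  -- The derivative of the extension at 1 along the real axis provides the limit of the difference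
  -- quotient of S at S 1 x.
  have h1 : HasDerivAt (fun t : ℝ => 1 + (t : ℂ)) 1 0 :=
    (Complex.ofRealCLM.hasDerivAt (x := (0 : ℝ))).const_add 1
  have h2 : HasDerivAt (fun t : ℝ => P (1 + (t : ℂ))) P' 0 := by
    have e : (Complex.reCLM.smulRight P' - Complex.imCLM.smulRight Q') (1 : ℂ) = P' := by simp
    have h := HasFDerivAt.comp_hasDerivAt (0 : ℝ)
      (show HasFDerivAt P (Complex.reCLM.smulRight P' - Complex.imCLM.smulRight Q')
        (1 + ((0 : ℝ) : ℂ)) by rwa [Complex.ofReal_zero, add_zero]) h1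
    rw [e] at h
    exact h
  have h3 := (h2.clm_apply (hasDerivAt_const (0 : ℝ) x)).tendsto_slope_zero_right
  refine ⟨P' x, (hB.2 _ _).2 ?_⟩
  simp only [map_zero, add_zero, zero_add] at h3
  refine h3.congr' ?_
  filter_upwards [self_mem_nhdsWithin] with t ht
  have ht : 0 < t := ht
  have e1 : P (1 + (t : ℂ)) = S (1 + t) := by
    rw [← (hPS (1 + t) (by linarith)).1]; push_cast; rfl
  have e2 : P (1 + ((0 : ℝ) : ℂ)) = S 1 := by
    rw [← (hPS 1 one_pos).1]; simp
  rw [e1, e2, ← hB.1.apply_add ht.le zero_le_one, add_comm]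

end DomainLemmas

/-! ### Semigroups and projections of a splitting on the scale of spaces -/

section SplittingLemmas

variable {X X₁ Xγ Y Y₁ Yδ : Type*}
  [NormedAddCommGroup X] [NormedSpace ℝ X] [NormedAddCommGroup X₁] [NormedSpace ℝ X₁]
  [NormedAddCommGroup Xγ] [NormedSpace ℝ Xγ] [NormedAddCommGroup Y] [NormedSpace ℝ Y]
  [NormedAddCommGroup Y₁] [NormedSpace ℝ Y₁] [NormedAddCommGroup Yδ] [NormedSpace ℝ Yδ]

/-- Points of `X₁` have orbits continuous in `X₁`; density of `X₁` in `Xγ` and the locally bounded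
smoothing estimate extend strong continuity to `Xγ`. -/
theorem System.exists_smoothing_A [CompleteSpace X] (sys : System X X₁ Xγ Y Y₁ Yδ) :
    ∃ T : ℝ → Xγ →L[ℝ] X₁, (∀ r > 0, ∀ x, sys.ιX (T r x) = sys.expA r (sys.ιXγ x)) ∧
      (∀ r > 0, ‖T r‖ ≤ sys.CA * r ^ (sys.γ - 1) * Real.exp (sys.ωA * r)) ∧
      ContinuousOn (fun p : ℝ × Xγ => T p.1 p.2) (Ioi 0 ×ˢ univ) := by
  refine exists_smoothing_family sys.domain_A.injective (P := fun r => sys.expA r ∘L sys.ιXγ)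
    (s := Ioi 0) ?_ ?_ (fun r hr x => sys.smoothing_A r hr x) sys.scale_X.dense_left ?_
  · have : ContinuousOn (fun r : ℝ => r ^ (sys.γ - 1)) (Ioi 0) := fun r hr =>
      (Real.continuousAt_rpow_const _ _ (Or.inl (ne_of_gt hr))).continuousWithinAt
    fun_prop
  · intro r hr
    have := sys.CA_pos
    have := Real.rpow_nonneg (le_of_lt hr) (sys.γ - 1)
    positivity
  · rintro _ ⟨x, rfl⟩
    obtain ⟨c, hc, hc'⟩ := sys.generates_A.exists_lift sys.domain_A x
    refine ⟨c, hc.mono Ioi_subset_Ici_self, fun r hr => ?_⟩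
    rw [hc' r (le_of_lt hr)]
    simp [sys.scale_X.comp_eq]

namespace Splitting

variable {sys : System X X₁ Xγ Y Y₁ Yδ} {ζ : ℝ} (spl : Splitting sys ζ)

/-- `YF ∩ Yδ`, with the norm of `Yδ`. -/
abbrev YFδ : Submodule ℝ Yδ := spl.YF.comap sys.ιYδ.toLinearMap

theorem isTopCompl [CompleteSpace Y] : spl.YF.IsTopCompl spl.YS :=
  Submodule.IsCompl.isTopCompl_of_isClosed spl.isCompl spl.isClosed_YF spl.isClosed_YS

theorem completeSpace_YF₁ [CompleteSpace Y₁] : CompleteSpace spl.YF₁ :=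
  (spl.isClosed_YF.preimage sys.ιY.continuous).completeSpace_coe

theorem completeSpace_YS₁ [CompleteSpace Y₁] : CompleteSpace spl.YS₁ :=
  (spl.isClosed_YS.preimage sys.ιY.continuous).completeSpace_coe

/-- The bounded projection of `Y` onto `YF`. -/
def prF [CompleteSpace Y] : Y →L[ℝ] Y :=
  spl.YF.subtypeL ∘L spl.YF.projectionOntoL spl.YS spl.isTopCompl

/-- The bounded projection of `Y` onto `YS`. -/
def prS [CompleteSpace Y] : Y →L[ℝ] spl.YS :=
  spl.YS.projectionOntoL spl.YF spl.isTopCompl.symm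

theorem prF_apply [CompleteSpace Y] (y : Y) :
    spl.prF y = spl.YF.projection spl.YS spl.isCompl y := rfl

theorem prS_apply [CompleteSpace Y] (y : Y) :
    spl.prS y = spl.YS.projectionOnto spl.YF spl.isCompl.symm y := rfl

theorem prF_mem [CompleteSpace Y] (y : Y) : spl.prF y ∈ spl.YF :=
  (spl.YF.projectionOntoL spl.YS spl.isTopCompl y).2

theorem prF_eq_self [CompleteSpace Y] {y : Y} (hy : y ∈ spl.YF) : spl.prF y = y := by
  rw [prF_apply]
  exact Submodule.projection_apply_left spl.isCompl ⟨y, hy⟩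

theorem coe_prS_eq_self [CompleteSpace Y] {y : Y} (hy : y ∈ spl.YS) : (spl.prS y : Y) = y := by
  rw [prS_apply]
  exact Submodule.projection_apply_left spl.isCompl.symm ⟨y, hy⟩

theorem exists_prF₁ [CompleteSpace Y] :
    ∃ p₁ : Y₁ →L[ℝ] Y₁, ∀ y, sys.ιY (p₁ y) = spl.prF (sys.ιY y) :=
  sys.domain_B.exists_restrict spl.commute_F

/-- The interpolation property enters here: the projection is bounded on `Y`, and on `Y₁` because it
commutes with B. -/
theorem exists_prFδ [CompleteSpace Y] :
    ∃ p : Yδ →L[ℝ] Yδ, ∀ y, sys.ιYδ (p y) = spl.prF (sys.ιYδ y) := by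
  obtain ⟨p₁, hp₁⟩ := spl.exists_prF₁
  obtain ⟨C, hC⟩ := sys.scale_Y.interpolation
  obtain ⟨p, hp, -⟩ := hC spl.prF p₁ hp₁
  exact ⟨p, hp⟩

theorem expB_mem_YF [CompleteSpace Y] {y : Y} (hy : y ∈ spl.YF) {t : ℝ} (ht : 0 ≤ t) :
    sys.expB t y ∈ spl.YF := by
  have h := sys.generates_B.commute (sys.domain_B.dense_domain sys.scale_Y) (p := spl.prF)
    spl.commute_F ht y
  rw [spl.prF_eq_self hy] at h
  rw [← h]
  exact spl.prF_mem _

theorem exists_smoothing_F [CompleteSpace Y] :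
    ∃ T : ℝ → spl.YFδ →L[ℝ] spl.YF₁,
      (∀ r > 0, ∀ y, sys.ιY (T r y) = sys.expB r (sys.ιYδ y)) ∧
      (∀ r > 0, ‖T r‖ ≤ spl.CB * r ^ (sys.δ - 1) * Real.exp ((spl.NF + ζ⁻¹ * sys.ωA) * r)) ∧
      ContinuousOn (fun p : ℝ × spl.YFδ => T p.1 p.2) (Ioi 0 ×ˢ univ) := by
  obtain ⟨p₁, hp₁⟩ := spl.exists_prF₁
  obtain ⟨p, hp⟩ := spl.exists_prFδ
  have hpmem : ∀ y, p y ∈ spl.YFδ := fun y => by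
    change sys.ιYδ (p y) ∈ spl.YF
    rw [hp]; exact spl.prF_mem _
  have hp₁mem : ∀ y, p₁ y ∈ spl.YF₁ := fun y => by
    change sys.ιY (p₁ y) ∈ spl.YF
    rw [hp₁]; exact spl.prF_mem _
  let p' : Yδ →L[ℝ] spl.YFδ := p.codRestrict spl.YFδ hpmem
  -- Because the projection is onto `YF ∩ Yδ`, the projected points of `Y₁` are dense there.
  have hsurj : Function.Surjective p' := fun y => ⟨y, Subtype.ext (sys.scale_Y.injective (by
    change sys.ιYδ (p y) = _
    rw [hp]; exact spl.prF_eq_self y.2))⟩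
  refine exists_smoothing_family (ι := sys.ιY ∘L spl.YF₁.subtypeL)
    (P := fun r => sys.expB r ∘L sys.ιYδ ∘L spl.YFδ.subtypeL) (s := Ioi 0)
    (sys.domain_B.injective.comp Subtype.val_injective) ?_ ?_ ?_
    (hsurj.denseRange.comp sys.scale_Y.dense_left p'.continuous) ?_
  · have : ContinuousOn (fun r : ℝ => r ^ (sys.δ - 1)) (Ioi 0) := fun r hr =>
      (Real.continuousAt_rpow_const _ _ (Or.inl (ne_of_gt hr))).continuousWithinAt
    fun_prop
  · intro r hr
    have := spl.CB_pos
    have := Real.rpow_nonneg (le_of_lt hr) (sys.δ - 1)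
    positivity
  · intro r hr y
    obtain ⟨z, hz, hzn⟩ := spl.decay_F r hr y y.2
    refine ⟨⟨z, ?_⟩, hz, hzn⟩
    change sys.ιY z ∈ spl.YF
    rw [hz]
    exact spl.expB_mem_YF y.2 (le_of_lt hr)
  · rintro _ ⟨y, rfl⟩
    obtain ⟨c, hc, hc'⟩ := sys.generates_B.exists_lift sys.domain_B (p₁ y)
    refine ⟨fun r => p₁.codRestrict spl.YF₁ hp₁mem (c r),
      (ContinuousLinearMap.continuous _).comp_continuousOn (hc.mono Ioi_subset_Ici_self),
      fun r hr => ?_⟩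
    change sys.ιY (p₁ (c r)) = sys.expB r (sys.ιYδ (p (sys.jY y)))
    rw [hp₁, hc' r (le_of_lt hr), hp, sys.scale_Y.comp_eq, hp₁]
    exact spl.prF_eq_self (spl.expB_mem_YF (spl.prF_mem _) (le_of_lt hr))

/-- For y in `YS ∩ Y₁` also B y lies in `YS`, so the group moves both continuously, and the orbit is
continuous in the graph norm. -/
theorem exists_group_S [CompleteSpace Y] :
    ∃ G : ℝ → spl.YS₁ →L[ℝ] spl.YS₁,
      (∀ r ≥ 0, ∀ y : spl.YS₁, sys.ιY (G r y) = spl.expS (-r) ⟨sys.ιY y, y.2⟩) ∧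
      (∀ r ≥ 0, ‖G r‖ ≤ spl.MB * Real.exp (-(spl.NS + ζ⁻¹ * sys.ωA) * r)) ∧
      ContinuousOn (fun p : ℝ × spl.YS₁ => G p.1 p.2) (Ici 0 ×ˢ univ) := by
  let ι : spl.YS₁ →L[ℝ] spl.YS := (sys.ιY ∘L spl.YS₁.subtypeL).codRestrict spl.YS fun y => y.2
  have hι : ∀ y : spl.YS₁, (ι y : Y) = sys.ιY y := fun y => rfl
  have hex := fun (r : ℝ) (hr : r ∈ Ici (0 : ℝ)) (y : spl.YS₁) => spl.decay_S r hr y y.2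
  have hP : ∀ r ∈ Ici (0 : ℝ), ∀ y, ∃ z, (spl.YS.subtypeL ∘L ι) z =
      (spl.YS.subtypeL ∘L spl.expS (-r) ∘L ι) y ∧
      ‖z‖ ≤ spl.MB * Real.exp (-(spl.NS + ζ⁻¹ * sys.ωA) * r) * ‖y‖ := fun r hr y => by
    obtain ⟨z, hz, hzn⟩ := hex r hr y
    refine ⟨⟨z, ?_⟩, hz, hzn⟩
    change sys.ιY z ∈ spl.YS
    rw [hz]
    exact (spl.expS (-r) _).2
  refine exists_smoothing_family (ι := spl.YS.subtypeL ∘L ι)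
    (P := fun r => spl.YS.subtypeL ∘L spl.expS (-r) ∘L ι) (s := Ici 0)
    (sys.domain_B.injective.comp Subtype.val_injective) (by fun_prop) ?_ hP dense_univ ?_
  · intro r hr
    have := spl.MB_pos
    positivity
  · intro y _
    obtain ⟨w, hw⟩ := sys.domain_B.exists_mem_graph y
    have hwS : (sys.ιY y, (spl.prS w : Y)) ∈ sys.B.graph := by
      have h := spl.commute_S _ _ hw
      have e : spl.YS.projection spl.YF spl.isCompl.symm (sys.ιY y) = sys.ιY y :=
        spl.coe_prS_eq_self y.2
      rw [e] at h
      exact h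
    have hgraph : (ι y, spl.prS w) ∈ (realization sys.B spl.YS).graph :=
      (mem_graph_realization_iff _ _ _ _).2 hwS
    choose! c hc using fun r hr => hP r hr y
    have hcc : ContinuousOn (fun r => (c r : Y₁)) (Ici 0) := by
      refine sys.domain_B.continuousOn_of_graph (y := fun r => (spl.expS (-r) (spl.prS w) : Y))
        ?_ ?_ ?_
      · have h1 : Continuous fun r : ℝ => (spl.expS (-r) (ι y) : Y) :=
          continuous_subtype_val.comp ((spl.generates_expS.1.continuous _).comp continuous_neg)
        exact h1.continuousOn.congr fun r hr => (hc r hr).1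
      · exact (continuous_subtype_val.comp
          ((spl.generates_expS.1.continuous _).comp continuous_neg)).continuousOn
      · intro r hr
        have h1 := (mem_graph_realization_iff _ _ _ _).1
          (spl.generates_expS.apply_mem_graph hgraph (-r))
        have h2 : sys.ιY (c r) = spl.expS (-r) (ι y) := (hc r hr).1
        rw [h2]
        exact h1
    exact ⟨c, continuousOn_iff_continuous_domRestrict.2
      ((continuousOn_iff_continuous_domRestrict.1 hcc).subtype_mk _), fun r hr => (hc r hr).1⟩

/-- The slow part of `Yδ` is contained in `Y₁`. -/
theorem exists_eq_prS [CompleteSpace Y] (y : Yδ) :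
    ∃ z : Y₁, sys.ιY z = spl.prS (sys.ιYδ y) := by
  rcases sys.δ_le_one.eq_or_lt with hδ | hδ
  · obtain ⟨y₁, rfl⟩ := sys.scale_Y.eq_of_one hδ y
    obtain ⟨w, hw⟩ := sys.domain_B.exists_mem_graph y₁
    obtain ⟨z, hz⟩ := sys.domain_B.exists_eq (spl.commute_S _ _ hw)
    refine ⟨z, ?_⟩
    rw [hz, sys.scale_Y.comp_eq, prS_apply, Submodule.coe_projectionOnto_apply]
  -- The group gives v = e^{B}(e^{-B}v), and the holomorphic semigroup maps into the domain of B.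
  · set v := spl.prS (sys.ιYδ y)
    obtain ⟨w, hw⟩ := (sys.holomorphic_B hδ).exists_mem_graph sys.generates_B (spl.expS (-1) v)
    have e : sys.expB 1 (spl.expS (-1) v) = v := by
      rw [← spl.expS_eq 1 zero_le_one, ← mul_apply_eq_comp, ← spl.generates_expS.1.map_add,
        add_neg_cancel, spl.generates_expS.1.map_zero]
      rfl
    rw [e] at hw
    exact sys.domain_B.exists_eq hw

/-- Closed graph theorem, with limits compared in `Y`. Boundedness makes the slow part of g
continuously differentiable into `Y₁`, which its Lipschitz estimate alone would not give. -/
theorem exists_prSδ [CompleteSpace Y] [CompleteSpace Y₁] [CompleteSpace Yδ] :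
    ∃ p : Yδ →L[ℝ] spl.YS₁, ∀ y, sys.ιY (p y) = spl.prS (sys.ιYδ y) := by
  have := spl.completeSpace_YS₁
  have hex : ∀ y, ∃ z : spl.YS₁, sys.ιY z = spl.prS (sys.ιYδ y) := fun y => by
    obtain ⟨z, hz⟩ := spl.exists_eq_prS y
    refine ⟨⟨z, ?_⟩, hz⟩
    change sys.ιY z ∈ spl.YS
    rw [hz]
    exact (spl.prS _).2
  choose z hz using hex
  have hinj : ∀ a b : spl.YS₁, sys.ιY a = sys.ιY b → a = b := fun a b h =>
    Subtype.ext (sys.domain_B.injective h)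
  let p₀ : Yδ →ₗ[ℝ] spl.YS₁ :=
    { toFun := z
      map_add' := fun x y => hinj _ _ (by simp [hz])
      map_smul' := fun a x => hinj _ _ (by simp [hz]) }
  have hp₀ : ∀ y, sys.ιY (p₀ y) = spl.prS (sys.ιYδ y) := hz
  refine ⟨ContinuousLinearMap.ofSeqClosedGraph (g := p₀) fun u x y hu hy => hinj _ _ ?_, hz⟩
  have h1 : Tendsto (fun n => sys.ιY (p₀ (u n))) atTop (𝓝 (sys.ιY y)) :=
    ((sys.ιY.continuous.comp continuous_subtype_val).tendsto y).comp hy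
  have h2 : Tendsto (fun n => (spl.prS (sys.ιYδ (u n)) : Y)) atTop
      (𝓝 (spl.prS (sys.ιYδ x) : Y)) :=
    ((continuous_subtype_val.comp (spl.prS.continuous.comp sys.ιYδ.continuous)).tendsto x).comp hu
  rw [hp₀]
  exact tendsto_nhds_unique (h1.congr fun n => hp₀ _) h2

end Splitting

end SplittingLemmas

/-! ### Weighted integrals of the kernel bound -/

section KernelBound

/-- The bound for the kernel of the Lyapunov-Perron operator. -/
def kernelBound (γ δ c₁ c₂ c₃ α₁ α₂ α₃ r : ℝ) : ℝ :=
  if 0 < r then c₁ * (r ^ (γ - 1) * Real.exp (α₁ * r)) + c₂ * (r ^ (δ - 1) * Real.exp (α₂ * r))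
  else c₃ * Real.exp (α₃ * r)

/-- The integral of `kernelBound` against the weight `exp (-μ r)`. -/
def kernelMass (γ δ c₁ c₂ c₃ α₁ α₂ α₃ μ : ℝ) : ℝ :=
  c₁ * ((1 / (μ - α₁)) ^ γ * Real.Gamma γ) + c₂ * ((1 / (μ - α₂)) ^ δ * Real.Gamma δ) +
    c₃ * (1 / (α₃ - μ))

theorem integrableOn_rpow_mul_exp {s α : ℝ} (hs : 0 < s) (hα : α < 0) :
    IntegrableOn (fun r : ℝ => r ^ (s - 1) * Real.exp (α * r)) (Ioi 0) := by
  have := integrableOn_rpow_mul_exp_neg_mul_rpow (p := 1) (s := s - 1) (b := -α)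
    (by linarith) one_pos (by linarith)
  simpa using this

theorem integral_rpow_mul_exp {s α : ℝ} (hs : 0 < s) (hα : α < 0) :
    ∫ r in Ioi (0 : ℝ), r ^ (s - 1) * Real.exp (α * r) = (1 / -α) ^ s * Real.Gamma s := by
  have := Real.integral_rpow_mul_exp_neg_mul_Ioi (a := s) (r := -α) hs (by linarith)
  simpa using this

variable {γ δ c₁ c₂ c₃ α₁ α₂ α₃ μ : ℝ}

theorem kernelBound_mul_exp_of_pos {r : ℝ} (hr : 0 < r) :
    kernelBound γ δ c₁ c₂ c₃ α₁ α₂ α₃ r * Real.exp (-μ * r) =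
      c₁ * (r ^ (γ - 1) * Real.exp ((α₁ - μ) * r)) +
        c₂ * (r ^ (δ - 1) * Real.exp ((α₂ - μ) * r)) := by
  have h : ∀ α, Real.exp ((α - μ) * r) = Real.exp (α * r) * Real.exp (-μ * r) := fun α => by
    rw [← Real.exp_add]; ring_nf
  rw [kernelBound, if_pos hr, h, h]
  ring

theorem kernelBound_mul_exp_of_nonpos {r : ℝ} (hr : r ≤ 0) :
    kernelBound γ δ c₁ c₂ c₃ α₁ α₂ α₃ r * Real.exp (-μ * r) =
      c₃ * Real.exp ((α₃ - μ) * r) := by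
  rw [kernelBound, if_neg (not_lt.2 hr), sub_mul, sub_eq_add_neg, ← neg_mul, Real.exp_add]
  ring

theorem integrable_kernelBound (hγ : 0 < γ) (hδ : 0 < δ) (h₁ : α₁ < μ) (h₂ : α₂ < μ)
    (h₃ : μ < α₃) :
    Integrable fun r => kernelBound γ δ c₁ c₂ c₃ α₁ α₂ α₃ r * Real.exp (-μ * r) := by
  rw [← integrableOn_univ, ← Iic_union_Ioi (a := (0 : ℝ)), integrableOn_union]
  constructor
  · exact IntegrableOn.congr_fun ((integrableOn_exp_mul_Iic (sub_pos.2 h₃) 0).const_mul c₃)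
      (fun r hr => (kernelBound_mul_exp_of_nonpos hr).symm) measurableSet_Iic
  · exact IntegrableOn.congr_fun
      (((integrableOn_rpow_mul_exp hγ (sub_neg.2 h₁)).const_mul c₁).add
        ((integrableOn_rpow_mul_exp hδ (sub_neg.2 h₂)).const_mul c₂))
      (fun r hr => (kernelBound_mul_exp_of_pos hr).symm) measurableSet_Ioi

/-- Two Gamma integrals on r > 0 and an exponential one on r ≤ 0, all convergent because μ separates
α₁, α₂ from α₃. -/
theorem integral_kernelBound (hγ : 0 < γ) (hδ : 0 < δ) (h₁ : α₁ < μ) (h₂ : α₂ < μ)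
    (h₃ : μ < α₃) :
    ∫ r, kernelBound γ δ c₁ c₂ c₃ α₁ α₂ α₃ r * Real.exp (-μ * r) =
      kernelMass γ δ c₁ c₂ c₃ α₁ α₂ α₃ μ := by
  have hi := integrable_kernelBound (c₁ := c₁) (c₂ := c₂) (c₃ := c₃) hγ hδ h₁ h₂ h₃
  rw [← integral_add_compl measurableSet_Ioi hi (s := Ioi 0), compl_Ioi,
    setIntegral_congr_fun measurableSet_Ioi fun r hr => kernelBound_mul_exp_of_pos hr,
    setIntegral_congr_fun measurableSet_Iic fun r hr => kernelBound_mul_exp_of_nonpos hr,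
    integral_add ((integrableOn_rpow_mul_exp hγ (sub_neg.2 h₁)).const_mul c₁)
      ((integrableOn_rpow_mul_exp hδ (sub_neg.2 h₂)).const_mul c₂),
    integral_const_mul, integral_const_mul, integral_const_mul,
    integral_rpow_mul_exp hγ (sub_neg.2 h₁), integral_rpow_mul_exp hδ (sub_neg.2 h₂),
    integral_exp_mul_Iic (sub_pos.2 h₃), kernelMass]
  simp

/-- The mass is continuous in the exponent and the inequalities are strict. The room gained is what
differentiability needs. -/
theorem exists_gt_kernelMass_lt_one (h₁ : α₁ < μ) (h₂ : α₂ < μ)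
    (h₃ : μ < α₃) (h : kernelMass γ δ c₁ c₂ c₃ α₁ α₂ α₃ μ < 1) :
    ∃ ν > μ, ν < α₃ ∧ kernelMass γ δ c₁ c₂ c₃ α₁ α₂ α₃ ν < 1 := by
  have d₃ : α₃ - μ ≠ 0 := (sub_pos.2 h₃).ne'
  have hp : ∀ {α s : ℝ}, α < μ → ContinuousAt (fun ν : ℝ => (1 / (ν - α)) ^ s) μ :=
      fun {α s} hα => by
    have h0 : 0 < μ - α := sub_pos.2 hα
    exact ContinuousAt.rpow_const (ContinuousAt.div (by fun_prop) (by fun_prop) h0.ne')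
      (Or.inl (by positivity))
  have hc : ContinuousAt (kernelMass γ δ c₁ c₂ c₃ α₁ α₂ α₃) μ := by
    unfold kernelMass
    exact ((((hp h₁).mul_const _).const_mul _).add (((hp h₂).mul_const _).const_mul _)).add
      ((ContinuousAt.div (by fun_prop) (by fun_prop) d₃).const_mul _)
  have hev : ∀ᶠ ν in 𝓝[>] μ, ν < α₃ ∧ kernelMass γ δ c₁ c₂ c₃ α₁ α₂ α₃ ν < 1 :=
    nhdsWithin_le_nhds ((gt_mem_nhds h₃).and (hc.eventually (gt_mem_nhds h)))
  obtain ⟨ν, hν, hν'⟩ := (hev.and self_mem_nhdsWithin).exists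
  exact ⟨ν, hν', hν⟩

/-- Γ is convex with Γ(1) = Γ(2) = 1, and 1 lies between δ and 2, so a value below 1 at δ would
violate convexity. -/
theorem one_le_Gamma (hδ : 0 < δ) (hδ1 : δ ≤ 1) : 1 ≤ Real.Gamma δ := by
  rcases hδ1.eq_or_lt with rfl | h
  · rw [Real.Gamma_one]
  have h3 : 0 < 2 - δ := by linarith
  have h1 := Real.convexOn_Gamma.2 (show δ ∈ Ioi (0 : ℝ) from hδ)
    (show (2 : ℝ) ∈ Ioi (0 : ℝ) by simp) (show 0 ≤ 1 / (2 - δ) by positivity)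
    (show 0 ≤ (1 - δ) / (2 - δ) by apply div_nonneg <;> linarith) (by field_simp; ring)
  have h2 : (1 / (2 - δ)) • δ + ((1 - δ) / (2 - δ)) • (2 : ℝ) = 1 := by
    simp only [smul_eq_mul]
    field_simp; ring
  rw [h2, Real.Gamma_one, Real.Gamma_two, smul_eq_mul, smul_eq_mul, mul_one, ← sub_le_iff_le_add]
    at h1
  have h4 : 1 - (1 - δ) / (2 - δ) = 1 / (2 - δ) := by field_simp; ring
  rw [h4, le_mul_iff_one_le_right (by positivity)] at h1
  exact h1

variable {X X₁ Xγ Y Y₁ Yδ : Type*}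
  [NormedAddCommGroup X] [NormedSpace ℝ X] [NormedAddCommGroup X₁] [NormedSpace ℝ X₁]
  [NormedAddCommGroup Xγ] [NormedSpace ℝ Xγ] [NormedAddCommGroup Y] [NormedSpace ℝ Y]
  [NormedAddCommGroup Y₁] [NormedSpace ℝ Y₁] [NormedAddCommGroup Yδ] [NormedSpace ℝ Yδ]
  {sys : System X X₁ Xγ Y Y₁ Yδ} {ζ ε : ℝ}

namespace Splitting

variable (spl : Splitting sys ζ)

/-- The bound for the kernel of the Lyapunov-Perron operator of a splitting. -/
def bound (ε : ℝ) : ℝ → ℝ :=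
  kernelBound sys.γ sys.δ (sys.Lf * sys.CA * ε⁻¹ ^ sys.γ) (sys.Lg * spl.CB)
    (sys.Lg * ζ ^ (sys.δ - 1) * spl.MB) (sys.ωA * ε⁻¹) (spl.NF + ζ⁻¹ * sys.ωA)
    (spl.NS + ζ⁻¹ * sys.ωA)

theorem GapCondition.lt_η {spl : Splitting sys ζ} (h : spl.GapCondition ε) (hε : 0 < ε) :
    sys.ωA * ε⁻¹ < spl.η := by
  rw [← div_eq_mul_inv, div_lt_iff₀ hε, η]
  have := h.1
  linarith

theorem add_NF_lt_η : spl.NF + ζ⁻¹ * sys.ωA < spl.η := by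
  have := spl.NF_lt_NS
  unfold η; linarith

theorem η_lt_add_NS : spl.η < spl.NS + ζ⁻¹ * sys.ωA := by
  have := spl.NF_lt_NS
  unfold η; linarith

/-- `η` is midway between the two growth rates of B, at distance (NS - NF)/2 from each, and ε(η -
ωA/ε) is half the first denominator of the gap condition. The first two terms agree; the third
differs by the factor Γ(δ) ≥ 1. -/
theorem GapCondition.kernelMass_lt_one {spl : Splitting sys ζ} (h : spl.GapCondition ε)
    (hε : 0 < ε) (hζ : 0 < ζ) :
    kernelMass sys.γ sys.δ (sys.Lf * sys.CA * ε⁻¹ ^ sys.γ) (sys.Lg * spl.CB)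
      (sys.Lg * ζ ^ (sys.δ - 1) * spl.MB) (sys.ωA * ε⁻¹) (spl.NF + ζ⁻¹ * sys.ωA)
      (spl.NS + ζ⁻¹ * sys.ωA) spl.η < 1 := by
  have hη₁ := sub_pos.2 (h.lt_η hε)
  obtain ⟨hD, hlt⟩ := h
  have hN : 0 < spl.NS - spl.NF := sub_pos.2 spl.NF_lt_NS
  refine lt_of_le_of_lt ?_ hlt
  set D := 2 * (ε * ζ⁻¹ - 1) * sys.ωA + ε * (spl.NS + spl.NF) with hDdef
  have e1 : ε⁻¹ * (1 / (spl.η - sys.ωA * ε⁻¹)) = 2 / D := by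
    have : D = 2 * (ε * (spl.η - sys.ωA * ε⁻¹)) := by
      rw [hDdef, η]; field_simp; ring
    rw [this]; field_simp
  have e2 : 1 / (spl.η - (spl.NF + ζ⁻¹ * sys.ωA)) = 2 / (spl.NS - spl.NF) := by
    have : spl.η - (spl.NF + ζ⁻¹ * sys.ωA) = (spl.NS - spl.NF) / 2 := by unfold η; ring
    rw [this, one_div_div]
  have e3 : 1 / (spl.NS + ζ⁻¹ * sys.ωA - spl.η) = 2 / (spl.NS - spl.NF) := by
    have : spl.NS + ζ⁻¹ * sys.ωA - spl.η = (spl.NS - spl.NF) / 2 := by unfold η; ring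
    rw [this, one_div_div]
  rw [kernelMass, e2, e3]
  refine add_le_add (add_le_add (le_of_eq ?_) (le_of_eq ?_)) ?_
  · calc _ = sys.Lf * sys.CA * (ε⁻¹ ^ sys.γ * (1 / (spl.η - sys.ωA * ε⁻¹)) ^ sys.γ) *
          Real.Gamma sys.γ := by ring
      _ = _ := by
        rw [← Real.mul_rpow (by positivity) (by positivity), e1,
          Real.div_rpow (by norm_num) hD.le]
        ring
  · rw [Real.div_rpow (by norm_num) hN.le]; ring
  · have := sys.Lg_pos
    have := spl.MB_pos
    have h0 : 0 ≤ sys.Lg * ζ ^ (sys.δ - 1) * spl.MB * (2 / (spl.NS - spl.NF)) := by positivity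
    calc _ ≤ sys.Lg * ζ ^ (sys.δ - 1) * spl.MB * (2 / (spl.NS - spl.NF)) * Real.Gamma sys.δ :=
          le_mul_of_one_le_right h0 (one_le_Gamma sys.δ_pos sys.δ_le_one)
      _ = _ := by ring

theorem GapCondition.exists_weight {spl : Splitting sys ζ} (h : spl.GapCondition ε)
    (hε : 0 < ε) (hζ : 0 < ζ) :
    (Integrable fun r => spl.bound ε r * Real.exp (-spl.η * r)) ∧
    ∫ r, spl.bound ε r * Real.exp (-spl.η * r) < 1 ∧
    ∃ ν > spl.η, ν < spl.NS + ζ⁻¹ * sys.ωA ∧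
      (Integrable fun r => spl.bound ε r * Real.exp (-ν * r)) ∧
      ∫ r, spl.bound ε r * Real.exp (-ν * r) < 1 := by
  have h₁ := h.lt_η hε
  have h₂ := spl.add_NF_lt_η
  have h₃ := spl.η_lt_add_NS
  have hm := h.kernelMass_lt_one hε hζ
  obtain ⟨ν, hν, hν₃, hνm⟩ := exists_gt_kernelMass_lt_one h₁ h₂ h₃ hm
  have hγ := sys.γ_pos
  have hδ := sys.δ_pos
  refine ⟨integrable_kernelBound hγ hδ h₁ h₂ h₃, ?_, ν, hν, hν₃,
    integrable_kernelBound hγ hδ (h₁.trans hν) (h₂.trans hν) hν₃, ?_⟩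
  · simp only [bound]
    rw [integral_kernelBound hγ hδ h₁ h₂ h₃]
    exact hm
  · simp only [bound]
    rw [integral_kernelBound hγ hδ (h₁.trans hν) (h₂.trans hν) hν₃]
    exact hνm

end Splitting

end KernelBound

/-! ### The Lyapunov-Perron operator as a convolution -/

section ConvComponents

variable {E Z W : Type*} [NormedAddCommGroup E] [NormedSpace ℝ E] [NormedAddCommGroup Z]
  [NormedSpace ℝ Z] [CompleteSpace Z] [NormedAddCommGroup W] [NormedSpace ℝ W] [CompleteSpace W]
  {T : ℝ → E →L[ℝ] Z} {φ : ℝ → E} {t : ℝ}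

theorem apply_conv (L : Z →L[ℝ] W) (hi : IntegrableOn (fun s => T (t - s) (φ s)) (Iic 0)) :
    L (conv T φ t) = ∫ s in Iic 0, L (T (t - s) (φ s)) :=
  (L.integral_comp_comm hi).symm

/-- The part of a convolution that depends on the past. -/
theorem apply_conv_eq_integral_Iic (L : Z →L[ℝ] W)
    (hi : IntegrableOn (fun s => T (t - s) (φ s)) (Iic 0)) (ht : t ≤ 0) {h : ℝ → W}
    (hlt : ∀ s < t, L (T (t - s) (φ s)) = h s) (hge : ∀ s, t ≤ s → L (T (t - s) (φ s)) = 0) :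
    L (conv T φ t) = ∫ s in Iic t, h s := by
  -- The value at s = t falls under `hge`; passing from `Iio` to `Iic` costs only a null set.
  have h1 : (fun s => L (T (t - s) (φ s))) = (Iio t).indicator h := by
    funext s
    rcases lt_or_ge s t with hs | hs
    · rw [indicator_of_mem (show s ∈ Iio t from hs), hlt s hs]
    · rw [indicator_of_notMem (show s ∉ Iio t from not_lt.2 hs), hge s hs]
  rw [apply_conv L hi, h1, setIntegral_indicator measurableSet_Iio,
    inter_eq_self_of_subset_right (Iio_subset_Iic_self.trans (Iic_subset_Iic.2 ht)),
    integral_Iic_eq_integral_Iio]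

/-- The part of a convolution that depends on the future. -/
theorem apply_conv_eq_intervalIntegral (L : Z →L[ℝ] W)
    (hi : IntegrableOn (fun s => T (t - s) (φ s)) (Iic 0)) (ht : t ≤ 0) {h : ℝ → W}
    (hlt : ∀ s < t, L (T (t - s) (φ s)) = 0)
    (hge : ∀ s, t ≤ s → s ≤ 0 → L (T (t - s) (φ s)) = -h s) :
    L (conv T φ t) = ∫ s in (0 : ℝ)..t, h s := by
  have h1 : EqOn (fun s => L (T (t - s) (φ s))) ((Ici t).indicator fun s => -h s) (Iic 0) := by
    intro s hs0
    rcases lt_or_ge s t with hs | hs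
    · rw [indicator_of_notMem (show s ∉ Ici t from not_le.2 hs)]
      exact hlt s hs
    · rw [indicator_of_mem (show s ∈ Ici t from hs)]
      exact hge s hs hs0
  rw [apply_conv L hi, setIntegral_congr_fun measurableSet_Iic h1,
    setIntegral_indicator measurableSet_Ici, inter_comm, Ici_inter_Iic, integral_neg,
    integral_Icc_eq_integral_Ioc, intervalIntegral.integral_of_ge ht]

end ConvComponents

/-! ### The nonlinearity and the kernel -/

section LyapunovPerron

variable {X X₁ Xγ Y Y₁ Yδ : Type*}
  [NormedAddCommGroup X] [NormedSpace ℝ X] [NormedAddCommGroup X₁] [NormedSpace ℝ X₁]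
  [NormedAddCommGroup Xγ] [NormedSpace ℝ Xγ] [NormedAddCommGroup Y] [NormedSpace ℝ Y]
  [NormedAddCommGroup Y₁] [NormedSpace ℝ Y₁] [NormedAddCommGroup Yδ] [NormedSpace ℝ Yδ]

/-- The semigroup generated by `A`, as a family of operators from `Xγ` to `X₁`. -/
def System.smoothA [CompleteSpace X] (sys : System X X₁ Xγ Y Y₁ Yδ) : ℝ → Xγ →L[ℝ] X₁ :=
  sys.exists_smoothing_A.choose

namespace Splitting

variable {sys : System X X₁ Xγ Y Y₁ Yδ} {ζ : ℝ} (spl : Splitting sys ζ)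

/-- The semigroup generated by `B`, as a family of operators from `YF ∩ Yδ` to `YF ∩ Y₁`. -/
def smoothF [CompleteSpace Y] : ℝ → spl.YFδ →L[ℝ] spl.YF₁ := spl.exists_smoothing_F.choose

/-- The group generated by `B` on `YS`, backwards in time, on `YS ∩ Y₁`. -/
def backwardS [CompleteSpace Y] : ℝ → spl.YS₁ →L[ℝ] spl.YS₁ := spl.exists_group_S.choose

/-- The projection onto `YF`, on `Yδ`. -/
def prFδ [CompleteSpace Y] : Yδ →L[ℝ] spl.YFδ :=
  spl.exists_prFδ.choose.codRestrict spl.YFδ fun y => by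
    change sys.ιYδ (spl.exists_prFδ.choose y) ∈ spl.YF
    rw [spl.exists_prFδ.choose_spec]
    exact spl.prF_mem _

/-- The projection onto `YS`, as an operator from `Yδ` to `YS ∩ Y₁`. -/
def prSδ [CompleteSpace Y] [CompleteSpace Y₁] [CompleteSpace Yδ] : Yδ →L[ℝ] spl.YS₁ :=
  spl.exists_prSδ.choose

theorem ιYδ_prFδ [CompleteSpace Y] (y : Yδ) :
    sys.ιYδ (spl.prFδ y) = spl.prF (sys.ιYδ y) := spl.exists_prFδ.choose_spec y

theorem ιY_prSδ [CompleteSpace Y] [CompleteSpace Y₁] [CompleteSpace Yδ] (y : Yδ) :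
    sys.ιY (spl.prSδ y) = spl.prS (sys.ιYδ y) := spl.exists_prSδ.choose_spec y

/-- The space `X₁ × (YF ∩ Y₁) × (YS ∩ Y₁)` with the sum norm. -/
abbrev Phase : Type _ := WithLp 1 (X₁ × WithLp 1 (spl.YF₁ × spl.YS₁))

/-- The space of the values of the nonlinearities. -/
abbrev Forcing : Type _ := Xγ × spl.YFδ × spl.YS₁

/-- Triples as elements of `Phase`. -/
def ofTriple : (X₁ × spl.YF₁ × spl.YS₁) →L[ℝ] spl.Phase :=
  (WithLp.prodContinuousLinearEquiv 1 ℝ X₁ (WithLp 1 (spl.YF₁ × spl.YS₁))).symm.toContinuousLinearMap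
    ∘L (ContinuousLinearMap.id ℝ X₁).prodMap
      (WithLp.prodContinuousLinearEquiv 1 ℝ spl.YF₁ spl.YS₁).symm.toContinuousLinearMap

/-- Elements of `Phase` as triples. -/
def triple : spl.Phase →L[ℝ] (X₁ × spl.YF₁ × spl.YS₁) :=
  (ContinuousLinearMap.id ℝ X₁).prodMap
      (WithLp.prodContinuousLinearEquiv 1 ℝ spl.YF₁ spl.YS₁).toContinuousLinearMap ∘L
    (WithLp.prodContinuousLinearEquiv 1 ℝ X₁ (WithLp 1 (spl.YF₁ × spl.YS₁))).toContinuousLinearMap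

theorem ofTriple_triple (z : spl.Phase) : spl.ofTriple (spl.triple z) = z := rfl

theorem norm_ofTriple (p : X₁ × spl.YF₁ × spl.YS₁) :
    ‖spl.ofTriple p‖ = ‖p.1‖ + ‖p.2.1‖ + ‖p.2.2‖ := by
  rw [WithLp.prod_norm_eq_of_L1, add_assoc]
  exact congrArg₂ (· + ·) rfl (WithLp.prod_norm_eq_of_L1 _)

theorem norm_eq_triple (z : spl.Phase) :
    ‖z‖ = ‖(spl.triple z).1‖ + ‖(spl.triple z).2.1‖ + ‖(spl.triple z).2.2‖ := by
  rw [← norm_ofTriple, ofTriple_triple]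

/-- The point `(x, yF + yS)` of `X₁ × Y₁` given by a triple. -/
def toPoint : spl.Phase →L[ℝ] X₁ × Y₁ :=
  ((ContinuousLinearMap.fst ℝ X₁ (spl.YF₁ × spl.YS₁)).prod
    (spl.YF₁.subtypeL ∘L ContinuousLinearMap.fst ℝ spl.YF₁ spl.YS₁ ∘L
        ContinuousLinearMap.snd ℝ X₁ (spl.YF₁ × spl.YS₁) +
      spl.YS₁.subtypeL ∘L ContinuousLinearMap.snd ℝ spl.YF₁ spl.YS₁ ∘L
        ContinuousLinearMap.snd ℝ X₁ (spl.YF₁ × spl.YS₁))) ∘L spl.triple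

/-- The inclusion of `Phase` into `X × Y × Y`. -/
def embed : spl.Phase →L[ℝ] X × Y × Y :=
  (sys.ιX.prodMap ((sys.ιY ∘L spl.YF₁.subtypeL).prodMap (sys.ιY ∘L spl.YS₁.subtypeL))) ∘L spl.triple

theorem embed_injective : Function.Injective spl.embed := by
  intro z z' h
  have h1 : sys.ιX (spl.triple z).1 = sys.ιX (spl.triple z').1 := congrArg Prod.fst h
  have h2 : sys.ιY (spl.triple z).2.1 = sys.ιY (spl.triple z').2.1 :=
    congrArg (fun p => p.2.1) h
  have h3 : sys.ιY (spl.triple z).2.2 = sys.ιY (spl.triple z').2.2 :=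
    congrArg (fun p => p.2.2) h
  rw [← spl.ofTriple_triple z, ← spl.ofTriple_triple z']
  exact congrArg _ (Prod.ext (sys.domain_A.injective h1)
    (Prod.ext (Subtype.ext (sys.domain_B.injective h2))
      (Subtype.ext (sys.domain_B.injective h3))))

section Nonlinearity

variable [CompleteSpace Y] [CompleteSpace Y₁] [CompleteSpace Yδ]

/-- The nonlinearity of the Lyapunov-Perron operator. -/
def nonlinearity (z : spl.Phase) : spl.Forcing :=
  (sys.Lf⁻¹ • sys.f (spl.toPoint z), sys.Lg⁻¹ • spl.prFδ (sys.g (spl.toPoint z)),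
    (sys.Lg * ζ ^ (sys.δ - 1))⁻¹ • spl.prSδ (sys.g (spl.toPoint z)))

theorem nonlinearity_zero : spl.nonlinearity 0 = 0 := by
  simp [nonlinearity, sys.f_zero, sys.g_zero]

theorem contDiff_nonlinearity (hC1 : sys.IsC1) : ContDiff ℝ 1 spl.nonlinearity := by
  have hf := hC1.contDiff_f.comp spl.toPoint.contDiff
  have hg := hC1.contDiff_g.comp spl.toPoint.contDiff
  exact (hf.const_smul _).prodMk (((spl.prFδ.contDiff.comp hg).const_smul _).prodMk
    ((spl.prSδ.contDiff.comp hg).const_smul _))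

/-- The source has the sum norm of the assumptions and the target the maximum norm, so each
component is normalised by its own constant. -/
theorem lipschitzWith_nonlinearity (hζ : 0 < ζ) : LipschitzWith 1 spl.nonlinearity := by
  have hLf := sys.Lf_pos
  have hLg := sys.Lg_pos
  have hζ' : 0 < ζ ^ (sys.δ - 1) := Real.rpow_pos_of_pos hζ _
  refine LipschitzWith.of_dist_le_mul fun z z' => ?_
  rw [dist_eq_norm, dist_eq_norm, NNReal.coe_one, one_mul]
  set p := spl.triple z with hp
  set p' := spl.triple z' with hp'
  have hN : ‖z - z'‖ = ‖p.1 - p'.1‖ + ‖(p.2.1 : Y₁) - p'.2.1‖ + ‖(p.2.2 : Y₁) - p'.2.2‖ := by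
    rw [norm_eq_triple, map_sub]; rfl
  have hz : spl.toPoint z = (p.1, (p.2.1 : Y₁) + p.2.2) := rfl
  have hz' : spl.toPoint z' = (p'.1, (p'.2.1 : Y₁) + p'.2.2) := rfl
  have hscale : ∀ {c a b : ℝ}, 0 < c → a ≤ c * b → c⁻¹ * a ≤ b := fun hc h => by
    rwa [inv_mul_le_iff₀ hc]
  refine norm_prod_le_iff.2 ⟨?_, norm_prod_le_iff.2 ⟨?_, ?_⟩⟩
  · change ‖sys.Lf⁻¹ • sys.f (spl.toPoint z) - sys.Lf⁻¹ • sys.f (spl.toPoint z')‖ ≤ _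
    rw [← smul_sub, norm_smul, Real.norm_of_nonneg (inv_pos.2 hLf).le]
    refine hscale hLf ((sys.lipschitz_f _ _).trans (mul_le_mul_of_nonneg_left ?_ hLf.le))
    rw [hN, hz, hz', add_assoc]
    refine add_le_add le_rfl ?_
    change ‖(p.2.1 : Y₁) + p.2.2 - (p'.2.1 + p'.2.2)‖ ≤ _
    rw [add_sub_add_comm]
    exact norm_add_le _ _
  · change ‖sys.Lg⁻¹ • spl.prFδ (sys.g (spl.toPoint z)) -
      sys.Lg⁻¹ • spl.prFδ (sys.g (spl.toPoint z'))‖ ≤ _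
    rw [← smul_sub, norm_smul, Real.norm_of_nonneg (inv_pos.2 hLg).le, ← map_sub]
    obtain ⟨w, hw, hwn⟩ := spl.lipschitz_F p.1 p'.1 p.2.1 p'.2.1 p.2.2 p'.2.2 p.2.1.2 p'.2.1.2
      p.2.2.2 p'.2.2.2
    have e : ((spl.prFδ (sys.g (spl.toPoint z) - sys.g (spl.toPoint z')) : spl.YFδ) : Yδ) = w :=
      sys.scale_Y.injective ((spl.ιYδ_prFδ _).trans hw.symm)
    refine hscale hLg ?_
    rw [← e, ← hN] at hwn
    exact hwn
  · change ‖(sys.Lg * ζ ^ (sys.δ - 1))⁻¹ • spl.prSδ (sys.g (spl.toPoint z)) -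
      (sys.Lg * ζ ^ (sys.δ - 1))⁻¹ • spl.prSδ (sys.g (spl.toPoint z'))‖ ≤ _
    have hc : 0 < sys.Lg * ζ ^ (sys.δ - 1) := by positivity
    rw [← smul_sub, norm_smul, Real.norm_of_nonneg (inv_pos.2 hc).le, ← map_sub]
    obtain ⟨w, hw, hwn⟩ := spl.lipschitz_S p.1 p'.1 p.2.1 p'.2.1 p.2.2 p'.2.2 p.2.1.2 p'.2.1.2
      p.2.2.2 p'.2.2.2
    have e : ((spl.prSδ (sys.g (spl.toPoint z) - sys.g (spl.toPoint z')) : spl.YS₁) : Y₁) = w :=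
      sys.domain_B.injective ((spl.ιY_prSδ _).trans hw.symm)
    refine hscale hc ?_
    rw [← e, ← hN] at hwn
    exact hwn

end Nonlinearity

section Kernel

variable [CompleteSpace X] [CompleteSpace Y]

/-- The kernel of the Lyapunov-Perron operator; the weights make the nonlinearity `1`-Lipschitz. -/
def kernel (ε r : ℝ) : spl.Forcing →L[ℝ] spl.Phase :=
  if 0 < r then
    spl.ofTriple ∘L (((sys.Lf * ε⁻¹) • sys.smoothA (ε⁻¹ * r)).prodMap
      ((sys.Lg • spl.smoothF r).prodMap (0 : spl.YS₁ →L[ℝ] spl.YS₁)))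
  else
    spl.ofTriple ∘L ((0 : Xγ →L[ℝ] X₁).prodMap
      ((0 : spl.YFδ →L[ℝ] spl.YF₁).prodMap
        (-(sys.Lg * ζ ^ (sys.δ - 1)) • spl.backwardS (-r))))

theorem kernel_apply_of_pos {ε r : ℝ} (hr : 0 < r) (e : spl.Forcing) :
    spl.kernel ε r e = spl.ofTriple ((sys.Lf * ε⁻¹) • sys.smoothA (ε⁻¹ * r) e.1,
      sys.Lg • spl.smoothF r e.2.1, 0) := by
  rw [kernel, if_pos hr]; rfl

theorem kernel_apply_of_nonpos {ε r : ℝ} (hr : r ≤ 0) (e : spl.Forcing) :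
    spl.kernel ε r e =
      spl.ofTriple (0, 0, -(sys.Lg * ζ ^ (sys.δ - 1)) • spl.backwardS (-r) e.2.2) := by
  rw [kernel, if_neg (not_lt.2 hr)]; rfl

/-- From the maximum norm to the sum norm, the operator norm for r > 0 is at most the sum of the two
smoothing bounds, matching the sum in the gap condition. -/
theorem isConvKernel {ε : ℝ} (hε : 0 < ε) (hζ : 0 < ζ) :
    IsConvKernel (spl.kernel ε) (spl.bound ε) := by
  obtain ⟨-, hAn, hAc⟩ := sys.exists_smoothing_A.choose_spec
  obtain ⟨-, hFn, hFc⟩ := spl.exists_smoothing_F.choose_spec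
  obtain ⟨-, hSn, hSc⟩ := spl.exists_group_S.choose_spec
  have hLf := sys.Lf_pos
  have hLg := sys.Lg_pos
  have hε' : 0 < ε⁻¹ := inv_pos.2 hε
  have hζ' : 0 < ζ ^ (sys.δ - 1) := Real.rpow_pos_of_pos hζ _
  constructor
  · rintro ⟨r, e⟩ ⟨hr, -⟩
    refine ContinuousAt.continuousWithinAt ?_
    rcases lt_or_gt_of_ne (show r ≠ 0 from hr) with h | h
    · have hnhds : Iio (0 : ℝ) ×ˢ (univ : Set spl.Forcing) ∈ 𝓝 (r, e) :=
        (isOpen_Iio.prod isOpen_univ).mem_nhds ⟨h, mem_univ _⟩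
      have h1 : ContinuousOn (fun p : ℝ × spl.Forcing => spl.backwardS (-p.1) p.2.2.2)
          (Iio 0 ×ˢ univ) :=
        hSc.comp (f := fun p : ℝ × spl.Forcing => (-p.1, p.2.2.2)) (by fun_prop)
          fun p hp => ⟨mem_Ici.2 (neg_nonneg.2 (le_of_lt hp.1)), mem_univ _⟩
      have h2 : ContinuousOn (fun p : ℝ × spl.Forcing => spl.ofTriple
          (0, 0, -(sys.Lg * ζ ^ (sys.δ - 1)) • spl.backwardS (-p.1) p.2.2.2)) (Iio 0 ×ˢ univ) :=
        spl.ofTriple.continuous.comp_continuousOn (continuousOn_const.prodMk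
          (continuousOn_const.prodMk (h1.fun_const_smul _)))
      refine (h2.continuousAt hnhds).congr ?_
      filter_upwards [hnhds] with p hp
      exact (spl.kernel_apply_of_nonpos (le_of_lt hp.1) _).symm
    · have hnhds : Ioi (0 : ℝ) ×ˢ (univ : Set spl.Forcing) ∈ 𝓝 (r, e) :=
        (isOpen_Ioi.prod isOpen_univ).mem_nhds ⟨h, mem_univ _⟩
      have h1 : ContinuousOn (fun p : ℝ × spl.Forcing => sys.smoothA (ε⁻¹ * p.1) p.2.1)
          (Ioi 0 ×ˢ univ) :=
        hAc.comp (f := fun p : ℝ × spl.Forcing => (ε⁻¹ * p.1, p.2.1)) (by fun_prop)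
          fun p hp => ⟨mul_pos hε' hp.1, mem_univ _⟩
      have h2 : ContinuousOn (fun p : ℝ × spl.Forcing => spl.smoothF p.1 p.2.2.1)
          (Ioi 0 ×ˢ univ) :=
        hFc.comp (f := fun p : ℝ × spl.Forcing => (p.1, p.2.2.1)) (by fun_prop)
          fun p hp => ⟨hp.1, mem_univ _⟩
      have h3 : ContinuousOn (fun p : ℝ × spl.Forcing => spl.ofTriple
          ((sys.Lf * ε⁻¹) • sys.smoothA (ε⁻¹ * p.1) p.2.1, sys.Lg • spl.smoothF p.1 p.2.2.1, 0))
          (Ioi 0 ×ˢ univ) :=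
        spl.ofTriple.continuous.comp_continuousOn ((h1.fun_const_smul _).prodMk
          ((h2.fun_const_smul _).prodMk continuousOn_const))
      refine (h3.continuousAt hnhds).congr ?_
      filter_upwards [hnhds] with p hp
      exact (spl.kernel_apply_of_pos hp.1 _).symm
  · intro r hr
    rcases lt_or_gt_of_ne hr with h | h
    · rw [bound, kernelBound, if_neg (not_lt.2 h.le)]
      have hMB := spl.MB_pos
      refine ContinuousLinearMap.opNorm_le_bound _ (by positivity) fun e => ?_
      have h1 := (spl.backwardS (-r)).le_of_opNorm_le_of_le (hSn (-r) (neg_nonneg.2 h.le))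
        ((norm_snd_le e.2).trans (norm_snd_le e))
      rw [spl.kernel_apply_of_nonpos h.le, norm_ofTriple]
      simp only [norm_zero, zero_add, norm_smul, norm_neg]
      rw [Real.norm_of_nonneg (by positivity)]
      calc _ ≤ sys.Lg * ζ ^ (sys.δ - 1) *
            (spl.MB * Real.exp (-(spl.NS + ζ⁻¹ * sys.ωA) * -r) * ‖e‖) :=
            mul_le_mul_of_nonneg_left h1 (by positivity)
        _ = _ := by rw [neg_mul_neg]; ring
    · rw [bound, kernelBound, if_pos h]
      have hCA := sys.CA_pos
      have hCB := spl.CB_pos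
      refine ContinuousLinearMap.opNorm_le_bound _ (by positivity) fun e => ?_
      have h1 := (sys.smoothA (ε⁻¹ * r)).le_of_opNorm_le_of_le (hAn _ (mul_pos hε' h))
        (norm_fst_le e)
      have h2 := (spl.smoothF r).le_of_opNorm_le_of_le (hFn r h)
        ((norm_fst_le e.2).trans (norm_snd_le e))
      rw [spl.kernel_apply_of_pos h, norm_ofTriple]
      simp only [norm_zero, add_zero, norm_smul]
      rw [Real.norm_of_nonneg (by positivity), Real.norm_of_nonneg hLg.le, add_mul]
      refine add_le_add ((mul_le_mul_of_nonneg_left h1 (by positivity)).trans_eq ?_)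
        ((mul_le_mul_of_nonneg_left h2 hLg.le).trans_eq ?_)
      -- The prefactor ε⁻¹ combines with (ε⁻¹ r)^(γ-1) to ε^(-γ) r^(γ-1).
      · have e1 : ε⁻¹ ^ sys.γ = ε⁻¹ * ε⁻¹ ^ (sys.γ - 1) := by
          rw [← Real.rpow_one_add' hε'.le (by simpa using sys.γ_pos.ne'), add_sub_cancel]
        rw [Real.mul_rpow hε'.le h.le, e1, ← mul_assoc sys.ωA]
        ring
      · ring

end Kernel

end Splitting

end LyapunovPerron

/-! ### Fixed points and the slow manifold map -/

section FixedPoints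

variable {X X₁ Xγ Y Y₁ Yδ : Type*}
  [NormedAddCommGroup X] [NormedSpace ℝ X] [NormedAddCommGroup X₁] [NormedSpace ℝ X₁]
  [NormedAddCommGroup Xγ] [NormedSpace ℝ Xγ] [NormedAddCommGroup Y] [NormedSpace ℝ Y]
  [NormedAddCommGroup Y₁] [NormedSpace ℝ Y₁] [NormedAddCommGroup Yδ] [NormedSpace ℝ Yδ]
  {sys : System X X₁ Xγ Y Y₁ Yδ} {ζ : ℝ}

namespace Splitting

variable (spl : Splitting sys ζ)

/-- A path on the negative half line, extended to the whole line. -/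
def extend (U : C(Iic (0 : ℝ), X₁ × spl.YF₁ × spl.YS₁)) (s : ℝ) : spl.Phase :=
  spl.ofTriple (IicExtend U s)

theorem extend_of_le (U : C(Iic (0 : ℝ), X₁ × spl.YF₁ × spl.YS₁)) {t : ℝ} (ht : t ≤ 0) :
    spl.extend U t = spl.ofTriple (U ⟨t, ht⟩) := by
  rw [extend, IicExtend_of_mem _ (show t ∈ Iic (0 : ℝ) from ht)]

theorem continuous_extend (U : C(Iic (0 : ℝ), X₁ × spl.YF₁ × spl.YS₁)) :
    Continuous (spl.extend U) :=
  spl.ofTriple.continuous.comp (U.continuous.comp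
    (Continuous.subtype_mk (by fun_prop : Continuous fun s : ℝ => min 0 s) _))

theorem memCη_iff (U : C(Iic (0 : ℝ), X₁ × spl.YF₁ × spl.YS₁)) :
    spl.MemCη U ↔ ∃ C, ∀ t ≤ 0, ‖spl.extend U t‖ ≤ C * Real.exp (spl.η * t) := by
  have key : ∀ (C : ℝ) (t : Iic (0 : ℝ)), Real.exp (-spl.η * t) *
      (‖(U t).1‖ + ‖(U t).2.1‖ + ‖(U t).2.2‖) ≤ C ↔
      ‖spl.extend U t‖ ≤ C * Real.exp (spl.η * t) := fun C t => by
    rw [spl.extend_of_le U t.2, norm_ofTriple, neg_mul, Real.exp_neg,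
      inv_mul_le_iff₀' (Real.exp_pos _)]
  constructor
  · rintro ⟨C, hC⟩
    exact ⟨C, fun t ht => (key C ⟨t, ht⟩).1 (hC ⟨⟨t, ht⟩, rfl⟩)⟩
  · rintro ⟨C, hC⟩
    refine ⟨C, ?_⟩
    rintro _ ⟨t, rfl⟩
    exact (key C t).2 (hC t t.2)

section Complete

variable [CompleteSpace Y]

/-- The free evolution of the slow variable, backwards in time. -/
def freeEvolution (t : ℝ) : spl.YS₁ →L[ℝ] spl.Phase :=
  spl.ofTriple ∘L (ContinuousLinearMap.inr ℝ X₁ (spl.YF₁ × spl.YS₁)) ∘L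
    (ContinuousLinearMap.inr ℝ spl.YF₁ spl.YS₁) ∘L spl.backwardS (-t)

theorem freeEvolution_apply (t : ℝ) (v : spl.YS₁) :
    spl.freeEvolution t v = spl.ofTriple (0, 0, spl.backwardS (-t) v) := rfl

theorem continuousOn_freeEvolution (v : spl.YS₁) :
    ContinuousOn (fun t => spl.freeEvolution t v) (Iic 0) := by
  obtain ⟨-, -, hSc⟩ := spl.exists_group_S.choose_spec
  have h1 : ContinuousOn (fun t : ℝ => spl.backwardS (-t) v) (Iic 0) :=
    hSc.comp (f := fun t : ℝ => (-t, v)) (by fun_prop)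
      fun t ht => ⟨mem_Ici.2 (neg_nonneg.2 ht), mem_univ _⟩
  exact spl.ofTriple.continuous.comp_continuousOn
    (continuousOn_const.prodMk (continuousOn_const.prodMk h1))

theorem norm_freeEvolution_le {ν : ℝ} (hν : ν ≤ spl.NS + ζ⁻¹ * sys.ωA) {t : ℝ} (ht : t ≤ 0) :
    ‖spl.freeEvolution t‖ ≤ spl.MB * Real.exp (ν * t) := by
  obtain ⟨-, hSn, -⟩ := spl.exists_group_S.choose_spec
  have hMB := spl.MB_pos
  refine ContinuousLinearMap.opNorm_le_bound _ (by positivity) fun v => ?_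
  rw [freeEvolution_apply, norm_ofTriple]
  simp only [norm_zero, zero_add]
  refine (spl.backwardS (-t)).le_of_opNorm_le ((hSn (-t) (neg_nonneg.2 ht)).trans ?_) v
  rw [neg_mul_neg]
  exact mul_le_mul_of_nonneg_left (exp_mul_le_exp_mul hν ht) hMB.le

variable [CompleteSpace X] [CompleteSpace X₁] [CompleteSpace Y₁] [CompleteSpace Yδ]

/-- Cutting the convolution at s = t, times s < t give the integrals over the past; times t ≤ s ≤ 0
give the integral from 0 to t, whose orientation absorbs the minus sign of the kernel. Integrability
in `Phase` lets the inclusions pass through the integral. -/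
theorem lyapunovPerron_eq {ε : ℝ} (hε : 0 < ε) (hζ : 0 < ζ)
    (hκ : Integrable fun r => spl.bound ε r * Real.exp (-spl.η * r)) (v : spl.YS₁)
    {U : C(Iic (0 : ℝ), X₁ × spl.YF₁ × spl.YS₁)} (hU : spl.MemCη U) {t : ℝ} (ht : t ≤ 0) :
    spl.lyapunovPerron ε v U t = spl.embed (spl.freeEvolution t v +
      conv (spl.kernel ε) (fun s => spl.nonlinearity (spl.extend U s)) t) := by
  have := spl.completeSpace_YF₁
  have := spl.completeSpace_YS₁
  obtain ⟨hA, -, -⟩ := sys.exists_smoothing_A.choose_spec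
  obtain ⟨hF, -, -⟩ := spl.exists_smoothing_F.choose_spec
  obtain ⟨hS, -, -⟩ := spl.exists_group_S.choose_spec
  obtain ⟨C, hC⟩ := (spl.memCη_iff U).1 hU
  have hlip := spl.lipschitzWith_nonlinearity hζ
  have hle : ∀ s ≤ 0, ‖spl.nonlinearity (spl.extend U s)‖ ≤ C * Real.exp (spl.η * s) :=
    fun s hs => by
      have h1 := norm_sub_le_of_lipschitzWith_one hlip (spl.extend U s) 0
      rw [spl.nonlinearity_zero, sub_zero, sub_zero] at h1
      exact h1.trans (hC s hs)
  have hi := (spl.isConvKernel hε hζ).integrableOn hκ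
    (φ := fun s => spl.nonlinearity (spl.extend U s))
    (hlip.continuous.comp (spl.continuous_extend U)).continuousOn hle t
  have hpt : ∀ s, spl.toPoint (spl.extend U s) = spl.point U s := fun s => rfl
  have hLf := sys.Lf_pos
  have hLg := sys.Lg_pos
  have hζ' : 0 < ζ ^ (sys.δ - 1) := Real.rpow_pos_of_pos hζ _
  have hc : sys.Lg * ζ ^ (sys.δ - 1) ≠ 0 := by positivity
  let L₁ : spl.Phase →L[ℝ] X := ContinuousLinearMap.fst ℝ X (Y × Y) ∘L spl.embed
  let L₂ : spl.Phase →L[ℝ] Y :=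
    ContinuousLinearMap.fst ℝ Y Y ∘L ContinuousLinearMap.snd ℝ X (Y × Y) ∘L spl.embed
  let L₃ : spl.Phase →L[ℝ] Y :=
    ContinuousLinearMap.snd ℝ Y Y ∘L ContinuousLinearMap.snd ℝ X (Y × Y) ∘L spl.embed
  have hL₁ : ∀ p, L₁ (spl.ofTriple p) = sys.ιX p.1 := fun p => rfl
  have hL₂ : ∀ p, L₂ (spl.ofTriple p) = sys.ιY p.2.1 := fun p => rfl
  have hL₃ : ∀ p, L₃ (spl.ofTriple p) = sys.ιY p.2.2 := fun p => rfl
  have h₁ := apply_conv_eq_integral_Iic L₁ hi ht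
    (h := fun s => ε⁻¹ • sys.expA (ε⁻¹ * (t - s)) (sys.ιXγ (sys.f (spl.point U s))))
    (fun s hs => by
      have hts : 0 < t - s := sub_pos.2 hs
      rw [spl.kernel_apply_of_pos hts, hL₁]
      simp only [map_smul, nonlinearity]
      rw [smul_smul, mul_right_comm, mul_inv_cancel₀ hLf.ne', one_mul, hpt]
      exact congrArg _ (hA _ (mul_pos (inv_pos.2 hε) hts) _))
    (fun s hs => by
      rw [spl.kernel_apply_of_nonpos (sub_nonpos.2 hs), hL₁, map_zero])
  have h₂ := apply_conv_eq_integral_Iic L₂ hi ht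
    (h := fun s => sys.expB (t - s)
      (spl.YF.projection spl.YS spl.isCompl (sys.ιYδ (sys.g (spl.point U s)))))
    (fun s hs => by
      have hts : 0 < t - s := sub_pos.2 hs
      rw [spl.kernel_apply_of_pos hts, hL₂]
      simp only [map_smul, nonlinearity, Submodule.coe_smul]
      rw [smul_smul, mul_inv_cancel₀ hLg.ne', one_smul, hpt]
      exact (hF _ hts _).trans (congrArg _ (spl.ιYδ_prFδ _)))
    (fun s hs => by
      rw [spl.kernel_apply_of_nonpos (sub_nonpos.2 hs), hL₂, ZeroMemClass.coe_zero, map_zero])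
  have h₃ := apply_conv_eq_intervalIntegral L₃ hi ht
    (h := fun s => (spl.expS (t - s)
      (spl.YS.projectionOnto spl.YF spl.isCompl.symm (sys.ιYδ (sys.g (spl.point U s)))) : Y))
    (fun s hs => by
      rw [spl.kernel_apply_of_pos (sub_pos.2 hs), hL₃, ZeroMemClass.coe_zero, map_zero])
    (fun s hs _ => by
      rw [spl.kernel_apply_of_nonpos (sub_nonpos.2 hs), hL₃]
      simp only [map_smul, nonlinearity, Submodule.coe_smul]
      rw [smul_smul, neg_mul, mul_inv_cancel₀ hc, neg_smul, one_smul, hpt]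
      refine congrArg _ ((hS _ (neg_nonneg.2 (sub_nonpos.2 hs)) _).trans ?_)
      rw [neg_neg]
      congr 2
      exact Subtype.ext (spl.ιY_prSδ _))
  have hfree : sys.ιY (spl.backwardS (-t) v) = spl.expS t ⟨sys.ιY v, v.2⟩ := by
    have := hS (-t) (neg_nonneg.2 ht) v
    rwa [neg_neg] at this
  rw [map_add, freeEvolution_apply]
  refine Prod.ext ?_ (Prod.ext ?_ ?_)
  · change ε⁻¹ • _ = sys.ιX 0 + L₁ _
    rw [h₁, map_zero, zero_add, integral_smul]
  · change _ = sys.ιY ((0 : spl.YF₁) : Y₁) + L₂ _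
    rw [h₂, ZeroMemClass.coe_zero, map_zero, zero_add]
    rfl
  · change _ = sys.ιY (spl.backwardS (-t) v) + L₃ _
    rw [h₃, hfree]
    rfl

/-- Fixed points of the Lyapunov-Perron operator are solutions of a convolution equation. -/
theorem isFixedPoint_iff {ε : ℝ} (hε : 0 < ε) (hζ : 0 < ζ)
    (hκ : Integrable fun r => spl.bound ε r * Real.exp (-spl.η * r)) (v : spl.YS₁)
    (U : C(Iic (0 : ℝ), X₁ × spl.YF₁ × spl.YS₁)) :
    spl.IsFixedPoint ε v U ↔ IsConvSolution (spl.kernel ε) spl.nonlinearity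
      (fun t => spl.freeEvolution t v) spl.η (spl.extend U) := by
  have hemb : ∀ t : Iic (0 : ℝ), (sys.ιX (U t).1, sys.ιY (U t).2.1, sys.ιY (U t).2.2) =
      spl.embed (spl.extend U t) := fun t => by
    rw [spl.extend_of_le U t.2]; rfl
  constructor
  · rintro ⟨hU, heq⟩
    refine ⟨(spl.continuous_extend U).continuousOn, (spl.memCη_iff U).1 hU, fun t ht => ?_⟩
    apply spl.embed_injective
    rw [← spl.lyapunovPerron_eq hε hζ hκ v hU ht, ← heq ⟨t, ht⟩, hemb]
  · intro h
    have hU := (spl.memCη_iff U).2 h.bounded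
    refine ⟨hU, fun t => ?_⟩
    rw [hemb, spl.lyapunovPerron_eq hε hζ hκ v hU t.2]
    exact congrArg _ (h.eq t t.2)

theorem existsUnique_isFixedPoint {ε : ℝ} (hε : 0 < ε) (hζ : 0 < ζ) (hgap : spl.GapCondition ε)
    (v : spl.YS₁) : ∃! U, spl.IsFixedPoint ε v U := by
  have := spl.completeSpace_YF₁
  have := spl.completeSpace_YS₁
  obtain ⟨hκ, hq, -⟩ := hgap.exists_weight hε hζ
  have hT := spl.isConvKernel hε hζ
  have hlip := spl.lipschitzWith_nonlinearity hζ
  obtain ⟨V, hV⟩ := hT.exists_convSolution hκ hq hlip spl.nonlinearity_zero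
    (spl.continuousOn_freeEvolution v) (C := spl.MB * ‖v‖) (fun t ht => by
      have := (spl.freeEvolution t).le_of_opNorm_le
        (spl.norm_freeEvolution_le spl.η_lt_add_NS.le ht) v
      exact this.trans_eq (by ring))
  let U : C(Iic (0 : ℝ), X₁ × spl.YF₁ × spl.YS₁) :=
    ⟨fun t => spl.triple (V t), spl.triple.continuous.comp
      (continuousOn_iff_continuous_domRestrict.1 hV.continuousOn)⟩
  have hUV : ∀ t ≤ 0, spl.extend U t = V t := fun t ht => by
    rw [spl.extend_of_le U ht]; rfl
  refine ⟨U, (spl.isFixedPoint_iff hε hζ hκ v U).2 (hV.congr hUV), fun U' hU' => ?_⟩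
  ext1 t
  have h := hT.eq_of_isConvSolution hκ hq hlip spl.nonlinearity_zero
    ((spl.isFixedPoint_iff hε hζ hκ v U').1 hU') hV t.2
  rw [spl.extend_of_le U' t.2] at h
  exact congrArg spl.triple h

theorem differentiable_slowManifoldMap (hC1 : sys.IsC1) {ε : ℝ} (hε : 0 < ε) (hζ : 0 < ζ)
    (hgap : spl.GapCondition ε) : Differentiable ℝ (spl.slowManifoldMap ε) := by
  have := spl.completeSpace_YF₁
  have := spl.completeSpace_YS₁
  -- As ν < NS + ζ⁻¹ωA, the free evolution is still bounded by a multiple of e^{νt}.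
  obtain ⟨hκ, hq, ν, hν, hνS, hκ', hq'⟩ := hgap.exists_weight hε hζ
  have hex : ∀ v, ∃ U, spl.IsFixedPoint ε v U := fun v =>
    (spl.existsUnique_isFixedPoint hε hζ hgap v).exists
  have hd := (spl.isConvKernel hε hζ).differentiable_solution hν hκ hq hκ' hq'
    (spl.contDiff_nonlinearity hC1) (spl.lipschitzWith_nonlinearity hζ) spl.nonlinearity_zero
    spl.continuousOn_freeEvolution (fun t ht => spl.norm_freeEvolution_le hνS.le ht)
    (U := fun v => spl.extend (hex v).choose)
    (fun v => (spl.isFixedPoint_iff hε hζ hκ v _).1 (hex v).choose_spec)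
  -- The choice of fixed point is the one in the definition, so the map is a bounded linear image of
  -- the solution at time 0.
  have heq : spl.slowManifoldMap ε = fun v =>
      ((ContinuousLinearMap.id ℝ X₁).prodMap (ContinuousLinearMap.fst ℝ spl.YF₁ spl.YS₁) ∘L
        spl.triple) (spl.extend (hex v).choose 0) := by
    funext v
    rw [slowManifoldMap, dif_pos (hex v), spl.extend_of_le _ le_rfl]
    rfl
  rw [heq]
  exact (ContinuousLinearMap.differentiable _).comp hd

end Complete

end Splitting

end FixedPoints

end FastSlow

end

theorem mainTheorem5 {X X₁ Xγ Y Y₁ Yδ : Type*}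
    [NormedAddCommGroup X] [NormedSpace ℝ X] [CompleteSpace X]
    [NormedAddCommGroup X₁] [NormedSpace ℝ X₁] [CompleteSpace X₁]
    [NormedAddCommGroup Xγ] [NormedSpace ℝ Xγ] [CompleteSpace Xγ]
    [NormedAddCommGroup Y] [NormedSpace ℝ Y] [CompleteSpace Y]
    [NormedAddCommGroup Y₁] [NormedSpace ℝ Y₁] [CompleteSpace Y₁]
    [NormedAddCommGroup Yδ] [NormedSpace ℝ Yδ] [CompleteSpace Yδ]
    (sys : FastSlow.System X X₁ Xγ Y Y₁ Yδ) (hC1 : sys.IsC1)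
    (ε ζ : ℝ) (hε : 0 < ε) (hζ : 0 < ζ)
    (spl : FastSlow.Splitting sys ζ) (hgap : spl.GapCondition ε) :
    (∀ v₀ : spl.YS₁, ∃! U : C(Set.Iic (0 : ℝ), X₁ × spl.YF₁ × spl.YS₁),
      spl.IsFixedPoint ε v₀ U) ∧
    Differentiable ℝ (spl.slowManifoldMap ε) :=
  ⟨spl.existsUnique_isFixedPoint hε hζ hgap, spl.differentiable_slowManifoldMap hC1 hε hζ hgap⟩
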